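/- Let $(M,g)$ be a smooth semi-Riemannian manifold with Levi-Civita connection $\breve\nabla$, and let $P$ be a locally Golden structure on it: a smooth $(1,1)$-tensor field with $P^2=P+I$, $g(PX,Y)=g(X,PY)$ and $\breve\nabla_X(PY)=P\breve\nabla_XY$. Let $N$ be a smooth manifold immersed in $M$ as a lightlike submanifold: the radical distribution $\mathrm{Rad}\,TN=TN\cap TN^{\perp}$ is a smooth distribution on $N$ of constant rank $r\ge 1$. Fix smooth vector bundles $S(TN)\subseteq TN$ (screen distribution), $S(TN^\perp)\subseteq TN^\perp$ (screen transversal bundle) and $\mathrm{ltr}(TN)\subseteq TM|_N$ such that $$TN=\mathrm{Rad}\,TN\perp S(TN),\qquad TN^\perp=\mathrm{Rad}\,TN\perp S(TN^\perp),$$ $$TM|_N=S(TN)\perp\bigl(\mathrm{Rad}\,TN\oplus \mathrm{ltr}(TN)\bigr)\perp S(TN^\perp).$$ (The fibres of $\mathrm{ltr}(TN)$ may be totally null, as for the usual lightlike transversal bundles, but this is not required.) Assume that $N$ is a transversal lightlike submanifold, that is, $$P(\mathrm{Rad}\,TN)=\mathrm{ltr}(TN),\qquad P(S(TN))\subseteq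 S(TN^\perp).$$ For $W\in\Gamma(TN)$ put $LW=P(QW)\in\Gamma(\mathrm{ltr}(TN))$, where $Q$ is the projection of $TN=\mathrm{Rad}\,TN\perp S(TN)$ onto $\mathrm{Rad}\,TN$. For $U\in\Gamma(TN)$ and $V\in\Gamma(\mathrm{ltr}(TN))$ let $D^s(U,V)$ be the component of $\breve\nabla_UV$ in $S(TN^\perp)$ with respect to $TM|_N=TN\oplus \mathrm{ltr}(TN)\oplus S(TN^\perp)$. Then the distribution $\mathrm{Rad}\,TN$ is integrable (through every point of $N$ there passes an integral manifold of it) if and only if $$D^s(U,LW)=D^s(W,LU)\qquad\text{for all } U,W\in\Gamma(\mathrm{Rad}\,TN).$$ -/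

import Mathlib

open Bundle Set
open scoped Manifold ContDiff

set_option linter.unusedSectionVars false

noncomputable section

namespace GoldenLightlike

/-! ### Golden semi-Riemannian manifolds -/

/-- A semi-Riemannian metric on a smooth `n`-manifold `M`: a smooth field of symmetric
nondegenerate bilinear forms on the tangent spaces. (The index of such a field is constant on
every connected component of `M`.) -/
structure SemiRiemannianMetric (n : ℕ) (M : Type*) [TopologicalSpace M]
    [ChartedSpace (EuclideanSpace ℝ (Fin n)) M] [IsManifold (𝓡 n) ∞ M] where
  val : Π p : M, TangentSpace (𝓡 n) p →L[ℝ] TangentSpace (𝓡 n) p →L[ℝ] ℝ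
  symm : ∀ (p : M) (v w : TangentSpace (𝓡 n) p), val p v w = val p w v
  nondegenerate : ∀ (p : M) (v : TangentSpace (𝓡 n) p), (∀ w, val p v w = 0) → v = 0
  contMDiff : ContMDiff (𝓡 n)
    ((𝓡 n).prod 𝓘(ℝ, EuclideanSpace ℝ (Fin n) →L[ℝ] EuclideanSpace ℝ (Fin n) →L[ℝ] ℝ)) ∞
    (fun p ↦ TotalSpace.mk' (EuclideanSpace ℝ (Fin n) →L[ℝ] EuclideanSpace ℝ (Fin n) →L[ℝ] ℝ)
      (E := fun p : M ↦ TangentSpace (𝓡 n) p →L[ℝ] TangentSpace (𝓡 n) p →L[ℝ] ℝ) p (val p))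

section Ambient

variable {n : ℕ} {M : Type*} [TopologicalSpace M]
  [ChartedSpace (EuclideanSpace ℝ (Fin n)) M] [IsManifold (𝓡 n) ∞ M]

/-- The metric at the point `p`, as a bilinear form. -/
def SemiRiemannianMetric.bilin (g : SemiRiemannianMetric n M) (p : M) :
    LinearMap.BilinForm ℝ (TangentSpace (𝓡 n) p) :=
  LinearMap.mk₂ ℝ (fun v w ↦ g.val p v w) (by simp) (by simp) (by simp) (by simp)

@[simp] theorem SemiRiemannianMetric.bilin_apply (g : SemiRiemannianMetric n M) (p : M)
    (v w : TangentSpace (𝓡 n) p) : g.bilin p v w = g.val p v w := rfl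

/-- The orthogonal complement `W^⊥` of a subspace `W` of `T_p M`. -/
def SemiRiemannianMetric.orthogonal (g : SemiRiemannianMetric n M) (p : M)
    (W : Submodule ℝ (TangentSpace (𝓡 n) p)) : Submodule ℝ (TangentSpace (𝓡 n) p) :=
  (g.bilin p).orthogonal W

/-- A Golden structure on the semi-Riemannian manifold `(M, g)`: a smooth `(1,1)`-tensor field `P`
with `P² = P + I`, for which the metric is compatible, that is `g(PX, Y) = g(X, PY)`. -/
structure GoldenStructure (g : SemiRiemannianMetric n M) where
  val : Π p : M, TangentSpace (𝓡 n) p →L[ℝ] TangentSpace (𝓡 n) p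
  contMDiff : ContMDiff (𝓡 n)
    ((𝓡 n).prod 𝓘(ℝ, EuclideanSpace ℝ (Fin n) →L[ℝ] EuclideanSpace ℝ (Fin n))) ∞
    (fun p ↦ TotalSpace.mk' (EuclideanSpace ℝ (Fin n) →L[ℝ] EuclideanSpace ℝ (Fin n))
      (E := fun p : M ↦ TangentSpace (𝓡 n) p →L[ℝ] TangentSpace (𝓡 n) p) p (val p))
  golden : ∀ (p : M) (v : TangentSpace (𝓡 n) p), val p (val p v) = val p v + v
  compatible : ∀ (p : M) (v w : TangentSpace (𝓡 n) p), g.val p (val p v) w = g.val p v (val p w)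

/-- `cov` is the Levi-Civita connection of `g`: it is torsion-free and
`X g(Y, Z) = g(∇_X Y, Z) + g(Y, ∇_X Z)`. The vector `(∇_X Y)_p` is written `cov Y p (X p)`. -/
structure IsLeviCivita (g : SemiRiemannianMetric n M)
    (cov : CovariantDerivative (𝓡 n) (EuclideanSpace ℝ (Fin n))
      (fun p : M ↦ TangentSpace (𝓡 n) p)) : Prop where
  torsion_eq_zero : cov.torsion = 0
  metric : ∀ (Y Z : Π p : M, TangentSpace (𝓡 n) p) (p : M),
    MDifferentiableAt (𝓡 n) (𝓡 n).tangent (fun q ↦ (⟨q, Y q⟩ : TangentBundle (𝓡 n) M)) p →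
    MDifferentiableAt (𝓡 n) (𝓡 n).tangent (fun q ↦ (⟨q, Z q⟩ : TangentBundle (𝓡 n) M)) p →
    ∀ X : TangentSpace (𝓡 n) p,
      mvfderiv (𝓡 n) (fun q ↦ g.val q (Y q) (Z q)) p X
        = g.val p (cov Y p X) (Z p) + g.val p (Y p) (cov Z p X)

/-- The Golden structure `P` is locally Golden: it is parallel, `∇_X (PY) = P (∇_X Y)`. -/
def GoldenStructure.IsLocallyGolden {g : SemiRiemannianMetric n M} (P : GoldenStructure g)
    (cov : CovariantDerivative (𝓡 n) (EuclideanSpace ℝ (Fin n))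
      (fun p : M ↦ TangentSpace (𝓡 n) p)) : Prop :=
  ∀ (Y : Π p : M, TangentSpace (𝓡 n) p) (p : M),
    MDifferentiableAt (𝓡 n) (𝓡 n).tangent (fun q ↦ (⟨q, Y q⟩ : TangentBundle (𝓡 n) M)) p →
    ∀ X : TangentSpace (𝓡 n) p, cov (fun q ↦ P.val q (Y q)) p X = P.val p (cov Y p X)

end Ambient

/-! ### Distributions -/

section Distributions

variable {m : ℕ} {N : Type*} [TopologicalSpace N]
  [ChartedSpace (EuclideanSpace ℝ (Fin m)) N] [IsManifold (𝓡 m) ∞ N]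

/-- A smooth vector field on `N`. -/
def IsSmoothField (W : Π x : N, TangentSpace (𝓡 m) x) : Prop :=
  ContMDiff (𝓡 m) (𝓡 m).tangent ∞ (fun x ↦ (⟨x, W x⟩ : TangentBundle (𝓡 m) N))

/-- `Γ(D)`: the smooth vector fields with values in the distribution `D`. -/
def IsSectionOf (D : Π x : N, Submodule ℝ (TangentSpace (𝓡 m) x))
    (W : Π x : N, TangentSpace (𝓡 m) x) : Prop :=
  IsSmoothField W ∧ ∀ x, W x ∈ D x

/-- `D` is a smooth distribution of rank `k` on `N`: it has smooth local frames of `k` fields. -/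
def IsSmoothDistribution (k : ℕ) (D : Π x : N, Submodule ℝ (TangentSpace (𝓡 m) x)) : Prop :=
  ∀ x₀ : N, ∃ (U : Set N) (e : Fin k → Π x : N, TangentSpace (𝓡 m) x), IsOpen U ∧ x₀ ∈ U ∧
    (∀ i, ContMDiffOn (𝓡 m) (𝓡 m).tangent ∞
      (fun x ↦ (⟨x, e i x⟩ : TangentBundle (𝓡 m) N)) U) ∧
    ∀ x ∈ U, LinearIndependent ℝ (fun i ↦ e i x) ∧ Submodule.span ℝ (range fun i ↦ e i x) = D x

/-- `D` is integrable: through every point of `N` there passes an integral manifold of `D`, that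
is, an (injectively) immersed submanifold whose tangent space at each of its points `y` is `D y`.
The integral manifold is given by a parametrization `φ` on an open set of some `ℝ^k`. -/
def IsIntegrable (D : Π x : N, Submodule ℝ (TangentSpace (𝓡 m) x)) : Prop :=
  ∀ x : N, ∃ (k : ℕ) (U : Set (EuclideanSpace ℝ (Fin k))) (φ : EuclideanSpace ℝ (Fin k) → N),
    IsOpen U ∧ x ∈ φ '' U ∧ InjOn φ U ∧ ContMDiffOn (𝓡 k) (𝓡 m) ∞ φ U ∧
    ∀ u ∈ U, Function.Injective (mfderiv (𝓡 k) (𝓡 m) φ u) ∧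
      LinearMap.range (mfderiv (𝓡 k) (𝓡 m) φ u).toLinearMap = D (φ u)

end Distributions

/-! ### Lightlike submanifolds -/

section Submanifolds

variable {m n : ℕ} {N M : Type*}
  [TopologicalSpace N] [ChartedSpace (EuclideanSpace ℝ (Fin m)) N] [IsManifold (𝓡 m) ∞ N]
  [TopologicalSpace M] [ChartedSpace (EuclideanSpace ℝ (Fin n)) M] [IsManifold (𝓡 n) ∞ M]

/-- The differential `T_x N → T_{f x} M`, as a linear map. -/
def differential (f : N → M) (x : N) :
    TangentSpace (𝓡 m) x →ₗ[ℝ] TangentSpace (𝓡 n) (f x) :=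
  (mfderiv (𝓡 m) (𝓡 n) f x).toLinearMap

/-- `S` is a smooth subbundle of rank `k` of the restriction `TM|_N` of `TM` along `f`: it has
smooth local frames of `k` vector fields along `f`. -/
def IsSmoothSubbundleAlong (f : N → M) (k : ℕ)
    (S : Π x : N, Submodule ℝ (TangentSpace (𝓡 n) (f x))) : Prop :=
  ∀ x₀ : N, ∃ (U : Set N) (e : Fin k → Π x : N, TangentSpace (𝓡 n) (f x)), IsOpen U ∧ x₀ ∈ U ∧
    (∀ i, ContMDiffOn (𝓡 m) (𝓡 n).tangent ∞
      (fun x ↦ (⟨f x, e i x⟩ : TangentBundle (𝓡 n) M)) U) ∧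
    ∀ x ∈ U, LinearIndependent ℝ (fun i ↦ e i x) ∧ Submodule.span ℝ (range fun i ↦ e i x) = S x

/-- The connection of `M` acting on vector fields `V` along `f : N → M`: the vector
`∇_u V ∈ T_{f x} M` for `u ∈ T_x N`. In the bundle chart of `TM` at `f x` it is the derivative of
the components of `V` in the direction `u`, plus the covariant derivative in the direction `df u`
of the local field which has constant components and the value `V x` at `f x`. -/
def covAlong (cov : CovariantDerivative (𝓡 n) (EuclideanSpace ℝ (Fin n))
      (fun p : M ↦ TangentSpace (𝓡 n) p))
    (f : N → M) (V : Π x : N, TangentSpace (𝓡 n) (f x)) (x : N) (u : TangentSpace (𝓡 m) x) :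
    TangentSpace (𝓡 n) (f x) :=
  (trivializationAt (EuclideanSpace ℝ (Fin n)) (TangentSpace (𝓡 n) : M → Type _) (f x)).symmL ℝ
      (f x) (mvfderiv (𝓡 m) (fun y ↦ (trivializationAt (EuclideanSpace ℝ (Fin n))
          (TangentSpace (𝓡 n) : M → Type _) (f x) ⟨f y, V y⟩).2) x u)
    + cov (FiberBundle.extend (EuclideanSpace ℝ (Fin n)) (V x)) (f x) (differential f x u)

/-- The normal space `T_x N^⊥ ⊆ T_{f x} M`. -/
def normalSpace (g : SemiRiemannianMetric n M) (f : N → M) (x : N) :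
    Submodule ℝ (TangentSpace (𝓡 n) (f x)) :=
  g.orthogonal (f x) (LinearMap.range (differential (m := m) f x))

/-- The radical `Rad T_x N = T_x N ∩ T_x N^⊥`, as a subspace of `T_x N`. -/
def radical (g : SemiRiemannianMetric n M) (f : N → M) (x : N) :
    Submodule ℝ (TangentSpace (𝓡 m) x) :=
  (normalSpace (m := m) g f x).comap (differential f x)

/-- The structure of a lightlike submanifold on `f : N → M`, with radical distribution of rank
`r ≥ 1`: an immersion together with a screen distribution `S(TN)`, a screen transversal bundle
`S(TN^⊥)` and a transversal bundle `ltr(TN)`, such that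
`TN = Rad TN ⊥ S(TN)`, `TN^⊥ = Rad TN ⊥ S(TN^⊥)` and
`TM|_N = S(TN) ⊥ (Rad TN ⊕ ltr(TN)) ⊥ S(TN^⊥)`.
The fibres of `ltr(TN)` are not required to be totally null, although the usual lightlike
transversal bundles have this property: every lightlike submanifold with a null `ltr(TN)`
is in particular a structure of this kind. -/
structure LightlikeSubmanifold (g : SemiRiemannianMetric n M) (f : N → M) (r : ℕ) where
  isImmersion : Manifold.IsImmersion (𝓡 m) (𝓡 n) ∞ f
  one_le_rank : 1 ≤ r
  radical_smooth : IsSmoothDistribution r (radical (m := m) g f)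
  /-- The screen distribution `S(TN)`. -/
  screen : Π x : N, Submodule ℝ (TangentSpace (𝓡 m) x)
  screen_smooth : ∃ k, IsSmoothDistribution k screen
  isCompl_screen : ∀ x, IsCompl (radical g f x) (screen x)
  /-- The screen transversal bundle `S(TN^⊥)`. -/
  screenTransversal : Π x : N, Submodule ℝ (TangentSpace (𝓡 n) (f x))
  screenTransversal_smooth : ∃ k, IsSmoothSubbundleAlong (m := m) f k screenTransversal
  screenTransversal_disjoint : ∀ x,
    Disjoint ((radical (m := m) g f x).map (differential f x)) (screenTransversal x)
  screenTransversal_sup : ∀ x,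
    (radical (m := m) g f x).map (differential f x) ⊔ screenTransversal x
      = normalSpace (m := m) g f x
  /-- The transversal bundle `ltr(TN)`. -/
  ltr : Π x : N, Submodule ℝ (TangentSpace (𝓡 n) (f x))
  ltr_smooth : ∃ k, IsSmoothSubbundleAlong (m := m) f k ltr
  ltr_disjoint : ∀ x, Disjoint ((radical (m := m) g f x).map (differential f x)) (ltr x)
  ltr_sup : ∀ x, (radical (m := m) g f x).map (differential f x) ⊔ ltr x
    = g.orthogonal (f x) ((screen x).map (differential f x) ⊔ screenTransversal x)

variable {g : SemiRiemannianMetric n M} {f : N → M} {r : ℕ}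

theorem SemiRiemannianMetric.bilin_isRefl (g : SemiRiemannianMetric n M) (p : M) :
    (g.bilin p).IsRefl := fun v w h ↦ by
  simp only [SemiRiemannianMetric.bilin_apply] at h ⊢
  rw [g.symm]; exact h

theorem SemiRiemannianMetric.bilin_nondegenerate (g : SemiRiemannianMetric n M) (p : M) :
    (g.bilin p).Nondegenerate :=
  ⟨fun v h ↦ g.nondegenerate p v h,
    fun v h ↦ g.nondegenerate p v fun w ↦ by rw [g.symm]; exact h w⟩

theorem SemiRiemannianMetric.mem_orthogonal (g : SemiRiemannianMetric n M) (p : M)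
    (W : Submodule ℝ (TangentSpace (𝓡 n) p)) (z : TangentSpace (𝓡 n) p) :
    z ∈ g.orthogonal p W ↔ ∀ w ∈ W, g.val p w z = 0 := Iff.rfl

theorem SemiRiemannianMetric.orthogonal_orthogonal (g : SemiRiemannianMetric n M) (p : M)
    (W : Submodule ℝ (TangentSpace (𝓡 n) p)) : g.orthogonal p (g.orthogonal p W) = W := by
  have : FiniteDimensional ℝ (TangentSpace (𝓡 n) p) :=
    inferInstanceAs (FiniteDimensional ℝ (EuclideanSpace ℝ (Fin n)))
  exact LinearMap.BilinForm.orthogonal_orthogonal (g.bilin_nondegenerate p) (g.bilin_isRefl p) W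

namespace LightlikeSubmanifold

variable (S : LightlikeSubmanifold (m := m) g f r)

/-- A vector of `S(TN)` that is orthogonal to `TN` vanishes. -/
theorem screen_eq_zero (x : N) {z : TangentSpace (𝓡 n) (f x)}
    (hz : z ∈ (S.screen x).map (differential f x)) (hz' : z ∈ normalSpace (m := m) g f x) :
    z = 0 := by
  obtain ⟨s, hs, rfl⟩ := hz
  have : s = 0 := (Submodule.disjoint_def.1 (S.isCompl_screen x).disjoint) s hz' hs
  simp [this]

/-- `TN = Rad TN + S(TN)`, inside `TM`. -/
theorem map_radical_sup_map_screen (x : N) :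
    (radical (m := m) g f x).map (differential (n := n) f x) ⊔ (S.screen x).map (differential (n := n) f x)
      = LinearMap.range (differential (m := m) (n := n) f x) := by
  rw [← Submodule.map_sup, (S.isCompl_screen x).sup_eq_top, Submodule.map_top]

/-- `S(TN) ⊥ S(TN^⊥)` is a nondegenerate subspace. -/
theorem screens_disjoint_orthogonal (x : N) :
    Disjoint ((S.screen x).map (differential (n := n) f x) ⊔ S.screenTransversal x)
      (g.orthogonal (f x) ((S.screen x).map (differential (n := n) f x) ⊔ S.screenTransversal x)) := by
  have hB : S.screenTransversal x ≤ normalSpace (m := m) g f x :=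
    le_sup_right.trans (S.screenTransversal_sup x).le
  have hA : (S.screen x).map (differential (n := n) f x) ≤ LinearMap.range (differential (m := m) (n := n) f x) :=
    LinearMap.map_le_range
  rw [Submodule.disjoint_def]
  intro z hz hz'
  rw [SemiRiemannianMetric.mem_orthogonal] at hz'
  obtain ⟨a, ha, b, hb, rfl⟩ := Submodule.mem_sup.1 hz
  have hN : ∀ v ∈ LinearMap.range (differential (m := m) (n := n) f x),
      ∀ w ∈ normalSpace (m := m) g f x, g.val (f x) v w = 0 := fun v hv w hw ↦ hw v hv
  have ha0 : a = 0 := by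
    refine S.screen_eq_zero x ha ?_
    rw [normalSpace, SemiRiemannianMetric.mem_orthogonal, ← S.map_radical_sup_map_screen x]
    intro w hw
    obtain ⟨c, hc, d, hd, rfl⟩ := Submodule.mem_sup.1 hw
    obtain ⟨ρ, hρ, rfl⟩ := hc
    have h1 : g.val (f x) (differential f x ρ) a = 0 := by
      rw [g.symm]; exact hN a (hA ha) _ hρ
    have h2 := hz' d (Submodule.mem_sup_left hd)
    have h3 := hN d (hA hd) b (hB hb)
    simp only [map_add, h3, add_zero] at h2
    simp [h1, h2]
  subst ha0
  have hb0 : b ∈ LinearMap.range (differential (m := m) (n := n) f x) := by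
    rw [← g.orthogonal_orthogonal (f x) (LinearMap.range (differential (m := m) (n := n) f x)),
      SemiRiemannianMetric.mem_orthogonal]
    intro w hw
    change w ∈ normalSpace (m := m) g f x at hw
    rw [← S.screenTransversal_sup x] at hw
    obtain ⟨c, hc, d, hd, rfl⟩ := Submodule.mem_sup.1 hw
    have h1 : g.val (f x) c b = 0 := hN c (LinearMap.map_le_range hc) b (hB hb)
    have h2 := hz' d (Submodule.mem_sup_right hd)
    simp only [zero_add] at h2
    simp [h1, h2]
  obtain ⟨v, rfl⟩ := hb0
  have hv : v ∈ radical (m := m) g f x := hB hb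
  simpa using (Submodule.disjoint_def.1 (S.screenTransversal_disjoint x)) _ ⟨v, hv, rfl⟩ hb

/-- The decomposition `TM|_N = S(TN^⊥) ⊕ (TN ⊕ ltr(TN))`. -/
theorem isCompl_screenTransversal (x : N) :
    IsCompl (S.screenTransversal x)
      (LinearMap.range (differential (m := m) (n := n) f x) ⊔ S.ltr x) := by
  have : FiniteDimensional ℝ (TangentSpace (𝓡 n) (f x)) :=
    inferInstanceAs (FiniteDimensional ℝ (EuclideanSpace ℝ (Fin n)))
  have hd := S.screens_disjoint_orthogonal x
  have htop := ((LinearMap.BilinForm.isCompl_orthogonal_iff_disjoint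
    (g.bilin_isRefl (f x))).2 hd).sup_eq_top
  change _ ⊔ g.orthogonal (f x) _ = ⊤ at htop
  have hR := S.map_radical_sup_map_screen x
  rw [← S.ltr_sup x] at hd htop
  rw [← hR]
  refine ⟨?_, ?_⟩
  · rw [Submodule.disjoint_def] at hd ⊢
    intro z hz hz'
    obtain ⟨t, ht, l, hl, rfl⟩ := Submodule.mem_sup.1 hz'
    obtain ⟨ρ, hρ, a, ha, rfl⟩ := Submodule.mem_sup.1 ht
    have h0 : ρ + l = 0 := by
      refine hd _ ?_ (Submodule.add_mem_sup hρ hl)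
      have : ρ + l = -a + (ρ + a + l) := by abel
      rw [this]
      exact Submodule.add_mem_sup (Submodule.neg_mem _ ha) hz
    have h1 : ρ + a + l = a := by
      rw [add_right_comm, h0, zero_add]
    rw [h1] at hz ⊢
    exact S.screen_eq_zero x ha ((le_sup_right.trans (S.screenTransversal_sup x).le) hz)
  · rw [codisjoint_iff, ← htop]
    ac_rfl

/-- The projection `Q` of `TN = Rad TN ⊥ S(TN)` onto `Rad TN`. -/
def projRadical (x : N) : TangentSpace (𝓡 m) x →ₗ[ℝ] TangentSpace (𝓡 m) x :=
  (radical g f x).subtype ∘ₗ (radical g f x).projectionOnto (S.screen x) (S.isCompl_screen x)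

/-- The projection of `TM|_N = TN ⊕ ltr(TN) ⊕ S(TN^⊥)` onto `S(TN^⊥)`. -/
def projScreenTransversal (x : N) : TangentSpace (𝓡 n) (f x) →ₗ[ℝ] TangentSpace (𝓡 n) (f x) :=
  (S.screenTransversal x).subtype ∘ₗ
    (S.screenTransversal x).projectionOnto _ (S.isCompl_screenTransversal x)

/-- `D^s(U, V)`, for a vector field `U` on `N` and a section `V` of `ltr(TN)`: the component in
`S(TN^⊥)` of `∇_U V = -A_V U + ∇^ℓ_U V + D^s(U, V)`. -/
def Ds (cov : CovariantDerivative (𝓡 n) (EuclideanSpace ℝ (Fin n))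
      (fun p : M ↦ TangentSpace (𝓡 n) p))
    (U : Π x : N, TangentSpace (𝓡 m) x) (V : Π x : N, TangentSpace (𝓡 n) (f x)) (x : N) :
    TangentSpace (𝓡 n) (f x) :=
  S.projScreenTransversal x (covAlong cov f V x (U x))

/-- `LW = P(QW)`, for a vector field `W` on `N`, as a vector field along `f`. -/
def L (P : GoldenStructure g) (W : Π x : N, TangentSpace (𝓡 m) x) (x : N) :
    TangentSpace (𝓡 n) (f x) :=
  P.val (f x) (differential f x (S.projRadical x (W x)))

/-- The lightlike submanifold is a transversal lightlike submanifold: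
`P(Rad TN) = ltr(TN)` and `P(S(TN)) ⊆ S(TN^⊥)`. -/
structure IsTransversal (P : GoldenStructure g) : Prop where
  map_radical : ∀ x, ((radical (m := m) g f x).map (differential (n := n) f x)).map
    (P.val (f x)).toLinearMap = S.ltr x
  map_screen : ∀ x, ((S.screen x).map (differential (n := n) f x)).map
    (P.val (f x)).toLinearMap ≤ S.screenTransversal x

end LightlikeSubmanifold

end Submanifolds

end GoldenLightlike

end

/-! For `U`, `W` in the radical, `LW = PW`. Since `P` is parallel, `∇_U(PW) - ∇_W(PU) = P(∇_U W -
∇_W U)`, and since the torsion vanishes this is `P[U,W]`. So `D^s(U,LW) - D^s(W,LU)` is the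
`S(TN^⊥)`-component of `P[U,W]` (`Ds_L_sub_Ds_L`).

Split a tangent vector as `v = ρ + s` along `Rad TN ⊥ S(TN)`. Transversality puts `Pρ` in `ltr(TN)`
and `Ps` in `S(TN^⊥)`, so the component of `Pv` is `Ps`. As `P² = P + I` makes `P` injective, it
vanishes exactly when `s = 0`, that is, when `v` is radical
(`projScreenTransversal_golden_eq_zero_iff`). The condition on `D^s` is therefore involutivity of
`Rad TN`, and Frobenius' theorem finishes the proof.

Integrable implies involutive (`IsIntegrable.mlieBracket_mem`): sections pull back to the parameter
domain of an integral manifold, and brackets are respected. Conversely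
(`IsSmoothDistribution.isIntegrable`), in a chart the distribution is the range of a smooth operator
field `G` with a constant left inverse `B`. Involutivity together with `BG = id` forces the columns
of `G` to commute. Then `φ' = G ∘ φ` is solved by integrating `γ' = G(γ)ξ` up to time 1 and setting
`φ(ξ) = γ(1)`; Grönwall's inequality gives the differential of `φ`. -/

noncomputable section

namespace GoldenLightlike

/-! ### Frobenius' theorem in a Banach space -/

section Frobenius

open Metric Filter Topology NNReal

variable {F E : Type*} [NormedAddCommGroup F] [NormedSpace ℝ F]
  [NormedAddCommGroup E] [NormedSpace ℝ E]

/-- A field of operators of class `C^∞` at a point, and its derivative, are bounded and Lipschitz on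
a small closed ball, with a common constant. -/
theorem exists_closedBall_lipschitz {H : Type*} [NormedAddCommGroup H] [NormedSpace ℝ H]
    {G : E → H} {y₀ : E} (hG : ContDiffAt ℝ ∞ G y₀) {s : Set E} (hs : s ∈ 𝓝 y₀) :
    ∃ R > 0, ∃ K : ℝ≥0, closedBall y₀ R ⊆ s ∧
      LipschitzOnWith K G (closedBall y₀ R) ∧ LipschitzOnWith K (fderiv ℝ G) (closedBall y₀ R) ∧
      ∀ y ∈ closedBall y₀ R, DifferentiableAt ℝ G y ∧ ‖G y‖ ≤ K ∧ ‖fderiv ℝ G y‖ ≤ K := by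
  have hG' : ContDiffAt ℝ 1 (fderiv ℝ G) y₀ := hG.fderiv_right (by norm_cast)
  have hG1 : ContDiffAt ℝ 1 G y₀ := hG.of_le (by norm_cast)
  obtain ⟨K₁, t₁, ht₁, h₁⟩ := hG1.exists_lipschitzOnWith
  obtain ⟨K₂, t₂, ht₂, h₂⟩ := hG'.exists_lipschitzOnWith
  have hd : ∀ᶠ y in 𝓝 y₀, DifferentiableAt ℝ G y := by
    filter_upwards [hG1.eventually (by simp)] with y hy using hy.differentiableAt one_ne_zero
  have b₁ : ∀ᶠ y in 𝓝 y₀, ‖G y‖ < ‖G y₀‖ + 1 :=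
    hG1.continuousAt.norm.eventually_lt_const (by linarith)
  have b₂ : ∀ᶠ y in 𝓝 y₀, ‖fderiv ℝ G y‖ < ‖fderiv ℝ G y₀‖ + 1 :=
    hG'.continuousAt.norm.eventually_lt_const (by linarith)
  obtain ⟨R, hR, hsub⟩ := Metric.nhds_basis_closedBall.mem_iff.1
    (inter_mem (inter_mem hs (inter_mem ht₁ ht₂)) (hd.and (b₁.and b₂)))
  have hK₁ : (0 : ℝ) ≤ K₁ := K₁.2
  have hK₂ : (0 : ℝ) ≤ K₂ := K₂.2
  have n₁ := norm_nonneg (G y₀)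
  have n₂ := norm_nonneg (fderiv ℝ G y₀)
  -- The sum dominates each of the four constants, so one `K` serves everywhere.
  refine ⟨R, hR, K₁ + K₂ + (‖G y₀‖₊ + 1) + (‖fderiv ℝ G y₀‖₊ + 1),
    fun y hy ↦ (hsub hy).1.1, (h₁.mono fun y hy ↦ (hsub hy).1.2.1).weaken ?_,
    (h₂.mono fun y hy ↦ (hsub hy).1.2.2).weaken ?_, fun y hy ↦ ⟨(hsub hy).2.1, ?_, ?_⟩⟩
  · rw [← NNReal.coe_le_coe]
    push_cast
    linarith
  · rw [← NNReal.coe_le_coe]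
    push_cast
    linarith
  · have := (hsub hy).2.2.1
    push_cast
    linarith
  · have := (hsub hy).2.2.2
    push_cast
    linarith

/-- Second order Taylor estimate, for a function with Lipschitz derivative. -/
theorem norm_sub_sub_fderiv_le {H : Type*} [NormedAddCommGroup H] [NormedSpace ℝ H]
    {G : E → H} {s : Set E} (hs : Convex ℝ s) {K : ℝ≥0} (hd : ∀ y ∈ s, DifferentiableAt ℝ G y)
    (hL : LipschitzOnWith K (fderiv ℝ G) s) {y z : E} (hy : y ∈ s) (hz : z ∈ s) :
    ‖G z - G y - fderiv ℝ G y (z - y)‖ ≤ K * ‖z - y‖ ^ 2 := by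
  have hseg : segment ℝ y z ⊆ s := hs.segment_subset hy hz
  -- Mean value inequality for `G - G'(y)` on the segment, where the derivative is at most `K‖z -
  -- y‖`. The factor 1/2 of the sharp estimate is not needed.
  have := (convex_segment y z).norm_image_sub_le_of_norm_hasFDerivWithin_le' (f := G)
    (f' := fderiv ℝ G) (φ := fderiv ℝ G y) (C := K * ‖z - y‖)
    (fun x hx ↦ (hd x (hseg hx)).hasFDerivAt.hasFDerivWithinAt) ?_
    (left_mem_segment ℝ y z) (right_mem_segment ℝ y z)
  · calc _ ≤ _ := this
      _ = _ := by ring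
  · intro x hx
    refine (hL.norm_sub_le (hseg hx) hy).trans ?_
    gcongr
    obtain ⟨a, b, ha, hb, hab, rfl⟩ := hx
    have : a • y + b • z - y = b • (z - y) := by
      rw [← eq_sub_iff_add_eq] at hab; subst hab; module
    rw [this, norm_smul, Real.norm_of_nonneg hb]
    exact mul_le_of_le_one_left (norm_nonneg _) (by linarith)

/-- The Picard–Lindelöf theorem for an autonomous field on a closed ball, with a solution that stays
in the ball. -/
theorem exists_solution_mem_closedBall [CompleteSpace E] {v : E → E} {y₀ : E} {a K : ℝ≥0}
    (hv : LipschitzOnWith K v (closedBall y₀ a)) (hb : ∀ y ∈ closedBall y₀ a, ‖v y‖ ≤ a) :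
    ∃ γ : ℝ → E, γ 0 = y₀ ∧ ∀ t ∈ Icc (0 : ℝ) 1, γ t ∈ closedBall y₀ a ∧
      HasDerivWithinAt γ (v (γ t)) (Icc 0 1) t := by
  have hf : IsPicardLindelof (fun _ ↦ v) (⟨0, by simp⟩ : Icc (0 : ℝ) 1) y₀ a 0 a K :=
    { lipschitzOnWith := fun _ _ ↦ hv
      continuousOn := fun _ _ ↦ continuousOn_const
      norm_le := fun _ _ ↦ hb
      mul_max_le := by simp }
  -- The Picard fixed point itself is used, because its function space records that the curve stays
  -- in the ball.
  obtain ⟨α, hα⟩ := ODE.FunSpace.exists_isFixedPt_next hf (mem_closedBall_self le_rfl)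
  refine ⟨α.compProj, ?_, fun t ht ↦ ⟨α.compProj_mem_closedBall hf.mul_max_le, ?_⟩⟩
  · have := ODE.FunSpace.compProj_val (α := α) (t := (⟨0, by simp⟩ : Icc (0 : ℝ) 1))
    rw [this, ← hα, ODE.FunSpace.next_apply₀]
  · apply ODE.hasDerivWithinAt_picard_Icc (⟨0, by simp⟩ : Icc (0 : ℝ) 1).2 hf.continuousOn_uncurry
      α.continuous_compProj.continuousOn (fun _ _ ↦ α.compProj_mem_closedBall hf.mul_max_le)
      y₀ ht |>.congr_of_mem _ ht
    intro t' ht'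
    nth_rw 1 [← hα]
    rw [ODE.FunSpace.compProj_of_mem ht', ODE.FunSpace.next_apply]

/-- Frobenius' theorem for a field `G` of operators `F → E` whose columns commute: through `y₀`
there passes a map `φ` with differential `G ∘ φ`. -/
theorem exists_hasFDerivAt_of_symm [CompleteSpace E] {G : E → F →L[ℝ] E} {y₀ : E}
    (hG : ContDiffAt ℝ ∞ G y₀) {s : Set E} (hs : s ∈ 𝓝 y₀)
    (hsymm : ∀ y ∈ s, ∀ ξ η, fderiv ℝ G y (G y ξ) η = fderiv ℝ G y (G y η) ξ) :
    ∃ δ > 0, ∃ φ : F → E, φ 0 = y₀ ∧ ∀ ξ ∈ ball (0 : F) δ,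
      φ ξ ∈ s ∧ HasFDerivAt φ (G (φ ξ)) ξ := by
  obtain ⟨R, hR, K, hsub, hL, hL', hb⟩ := exists_closedBall_lipschitz hG hs
  have hK : (0 : ℝ) ≤ K := K.2
  -- Solutions are confined to the half ball; the other `R / 2` leaves room for the perturbed curve
  -- `w` below.
  set a : ℝ≥0 := ⟨R / 2, by positivity⟩ with ha
  have ha' : (a : ℝ) = R / 2 := rfl
  have hsub' : closedBall y₀ a ⊆ closedBall y₀ R := closedBall_subset_closedBall (by linarith)
  -- `δ ≤ 1` keeps `K` as Lipschitz constant of `G(·)ξ`; `Kδ ≤ R / 2` bounds the speed, so that a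
  -- solution cannot leave the half ball before time 1.
  obtain ⟨δ, hδ, hδ1, hδK⟩ : ∃ δ > 0, δ ≤ 1 ∧ K * δ ≤ R / 2 := by
    refine ⟨min 1 (R / 2 / (K + 1)), by positivity, min_le_left _ _, ?_⟩
    calc K * min 1 (R / 2 / (K + 1)) ≤ (K + 1) * (R / 2 / (K + 1)) := by
          gcongr
          · linarith
          · exact min_le_right _ _
      _ = R / 2 := by field_simp
  have hLξ : ∀ ξ ∈ ball (0 : F) δ, LipschitzOnWith K (fun y ↦ G y ξ) (closedBall y₀ R) := by
    intro ξ hξ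
    have hξ1 : ‖ξ‖ ≤ 1 := (mem_ball_zero_iff.1 hξ).le.trans hδ1
    refine LipschitzOnWith.of_dist_le_mul fun y hy z hz ↦ ?_
    rw [dist_eq_norm, dist_eq_norm, ← sub_apply]
    calc ‖(G y - G z) ξ‖ ≤ ‖G y - G z‖ * ‖ξ‖ := ContinuousLinearMap.le_opNorm _ _
      _ ≤ (K * ‖y - z‖) * 1 := by
          gcongr
          exact hL.norm_sub_le hy hz
      _ = _ := mul_one _
  have hex : ∀ ξ : F, ∃ γ : ℝ → E, γ 0 = y₀ ∧ (ξ ∈ ball (0 : F) δ → ∀ t ∈ Icc (0 : ℝ) 1,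
      γ t ∈ closedBall y₀ a ∧ HasDerivWithinAt γ (G (γ t) ξ) (Icc 0 1) t) := by
    intro ξ
    by_cases hξ : ξ ∈ ball (0 : F) δ
    · obtain ⟨γ, h0, h⟩ := exists_solution_mem_closedBall ((hLξ ξ hξ).mono hsub') (by
        intro y hy
        calc ‖G y ξ‖ ≤ ‖G y‖ * ‖ξ‖ := ContinuousLinearMap.le_opNorm _ _
          _ ≤ K * δ := by
            gcongr
            · exact (hb y (hsub' hy)).2.1
            · exact (mem_ball_zero_iff.1 hξ).le
          _ ≤ a := hδK)
      exact ⟨γ, h0, fun _ ↦ h⟩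
    · exact ⟨fun _ ↦ y₀, rfl, fun h ↦ absurd h hξ⟩
  choose γ hγ0 hγ using hex
  have h01 : (1 : ℝ) ∈ Icc (0 : ℝ) 1 := by simp
  -- For `ξ = 0` the velocity vanishes and the curve is constant.
  have hzero : γ 0 1 = y₀ := by
    have hc : ∀ t ∈ Icc (0 : ℝ) 1, HasDerivWithinAt (γ 0) 0 (Icc 0 1) t := fun t ht ↦ by
      simpa using (hγ 0 (mem_ball_self hδ) t ht).2
    have := (convex_Icc (0 : ℝ) 1).norm_image_sub_le_of_norm_hasDerivWithin_le (C := 0) hc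
      (by simp) (left_mem_Icc.2 zero_le_one) h01
    rw [← hγ0 0, ← sub_eq_zero, ← norm_le_zero_iff]
    simpa using this
  refine ⟨δ, hδ, fun ξ ↦ γ ξ 1, hzero, fun ξ hξ ↦ ⟨hsub (hsub' (hγ ξ hξ 1 h01).1), ?_⟩⟩
  have hξ1 : ‖ξ‖ ≤ 1 := (mem_ball_zero_iff.1 hξ).le.trans hδ1
  have hcont : ∀ ζ ∈ ball (0 : F) δ, ContinuousOn (γ ζ) (Icc 0 1) :=
    fun ζ hζ t ht ↦ (hγ ζ hζ t ht).2.continuousWithinAt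
  have hright : ∀ {c : ℝ → E} {c' : E} {t : ℝ}, t ∈ Ico (0 : ℝ) 1 →
      HasDerivWithinAt c c' (Icc 0 1) t → HasDerivWithinAt c c' (Ici t) t := by
    intro c c' t ht h
    exact h.mono_of_mem_nhdsWithin (mem_of_superset (Icc_mem_nhdsGE ht.2)
      (Icc_subset_Icc_left ht.1))
  -- An error quadratic in `η` suffices for the differential at `ξ`.
  have key : ∀ᶠ η in 𝓝 (0 : F), ‖γ (ξ + η) 1 - γ ξ 1 - G (γ ξ 1) η‖
      ≤ gronwallBound 0 K ((K ^ 3 + K ^ 2) * ‖η‖ ^ 2) 1 := by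
    have e₁ : ∀ᶠ η in 𝓝 (0 : F), ξ + η ∈ ball (0 : F) δ :=
      (continuous_const.add continuous_id).continuousAt.eventually_mem
        (isOpen_ball.mem_nhds (by simpa using hξ))
    have e₂ : ∀ᶠ η in 𝓝 (0 : F), η ∈ ball (0 : F) δ := ball_mem_nhds _ hδ
    filter_upwards [e₁, e₂] with η hη hη'
    have hη1 : ‖ξ + η‖ ≤ 1 := (mem_ball_zero_iff.1 hη).le.trans hδ1
    set c := γ ξ with hc
    have hcm : ∀ t ∈ Icc (0 : ℝ) 1, c t ∈ closedBall y₀ R := fun t ht ↦ hsub' (hγ ξ hξ t ht).1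
    have hGη : ∀ t ∈ Icc (0 : ℝ) 1, ‖t • G (c t) η‖ ≤ K * ‖η‖ := by
      intro t ht
      calc ‖t • G (c t) η‖ = t * ‖G (c t) η‖ := by rw [norm_smul, Real.norm_of_nonneg ht.1]
        _ ≤ 1 * (K * ‖η‖) := by
            gcongr
            · exact ht.2
            · exact ((G (c t)).le_opNorm η).trans (by gcongr; exact (hb _ (hcm t ht)).2.1)
        _ = _ := one_mul _
    -- First-order guess for `γ (ξ + η)`: by the symmetry of `G'`, the correction `t G(c)η` solves
    -- the equation linearized along `c`.
    set w : ℝ → E := fun t ↦ c t + t • G (c t) η with hw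
    have hwm : ∀ t ∈ Icc (0 : ℝ) 1, w t ∈ closedBall y₀ R := by
      intro t ht
      have h1 : ‖c t - y₀‖ ≤ R / 2 := mem_closedBall_iff_norm.1 (hγ ξ hξ t ht).1
      have h2 : ‖t • G (c t) η‖ ≤ R / 2 := (hGη t ht).trans
        ((mul_le_mul_of_nonneg_left (mem_ball_zero_iff.1 hη').le hK).trans hδK)
      rw [mem_closedBall_iff_norm]
      calc ‖w t - y₀‖ = ‖(c t - y₀) + t • G (c t) η‖ := by rw [sub_add_eq_add_sub]
        _ ≤ R := (norm_add_le _ _).trans (by linarith)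
    have hw' : ∀ t ∈ Icc (0 : ℝ) 1, HasDerivWithinAt w
        (G (c t) ξ + (t • (fderiv ℝ G (c t) (G (c t) ξ)) η + G (c t) η)) (Icc 0 1) t := by
      intro t ht
      have h1 := (hγ ξ hξ t ht).2
      have h2 : HasDerivWithinAt (fun t ↦ G (c t)) (fderiv ℝ G (c t) (G (c t) ξ)) (Icc 0 1) t :=
        (hb _ (hcm t ht)).1.hasFDerivAt.comp_hasDerivWithinAt t h1
      have h3 : HasDerivWithinAt (fun t ↦ G (c t) η) (fderiv ℝ G (c t) (G (c t) ξ) η)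
          (Icc 0 1) t := by
        simpa using h2.clm_apply (hasDerivWithinAt_const t (Icc 0 1) η)
      have h4 := h1.add ((hasDerivWithinAt_id t (Icc 0 1)).smul h3)
      simp only [id, one_smul] at h4
      exact h4
    have hbound : ∀ t ∈ Ico (0 : ℝ) 1,
        dist (G (c t) ξ + (t • (fderiv ℝ G (c t) (G (c t) ξ)) η + G (c t) η)) (G (w t) (ξ + η))
          ≤ (K ^ 3 + K ^ 2) * ‖η‖ ^ 2 := by
      intro t ht'
      have ht := Ico_subset_Icc_self ht'
      have hT := norm_sub_sub_fderiv_le (convex_closedBall y₀ R) (fun y hy ↦ (hb y hy).1) hL'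
        (hcm t ht) (hwm t ht)
      have hwc : w t - c t = t • G (c t) η := by simp [hw]
      rw [hwc] at hT
      have hsy := hsymm (c t) (hsub (hcm t ht)) ξ η
      -- The symmetry turns `G'(Gξ)η` into `G'(Gη)ξ`, so the defect of `w` is a Taylor remainder
      -- plus a term bilinear in `η`, both of second order.
      have hsplit : G (w t) (ξ + η)
          - (G (c t) ξ + (t • (fderiv ℝ G (c t) (G (c t) ξ)) η + G (c t) η))
          = (G (w t) - G (c t) - fderiv ℝ G (c t) (t • G (c t) η)) (ξ + η)
            + fderiv ℝ G (c t) (t • G (c t) η) η := by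
        simp only [map_smul, map_add, sub_apply, smul_apply, hsy]
        module
      rw [dist_comm, dist_eq_norm, hsplit]
      have i1 : ‖(G (w t) - G (c t) - fderiv ℝ G (c t) (t • G (c t) η)) (ξ + η)‖
          ≤ K ^ 3 * ‖η‖ ^ 2 := by
        calc _ ≤ _ := ContinuousLinearMap.le_opNorm _ _
          _ ≤ (K * ‖t • G (c t) η‖ ^ 2) * 1 := by gcongr
          _ ≤ (K * (K * ‖η‖) ^ 2) * 1 := by gcongr; exact hGη t ht
          _ = _ := by ring
      have i2 : ‖fderiv ℝ G (c t) (t • G (c t) η) η‖ ≤ K ^ 2 * ‖η‖ ^ 2 := by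
        calc _ ≤ ‖fderiv ℝ G (c t) (t • G (c t) η)‖ * ‖η‖ := ContinuousLinearMap.le_opNorm _ _
          _ ≤ (‖fderiv ℝ G (c t)‖ * ‖t • G (c t) η‖) * ‖η‖ := by
            gcongr; exact ContinuousLinearMap.le_opNorm _ _
          _ ≤ (K * (K * ‖η‖)) * ‖η‖ := by
            gcongr
            · exact (hb _ (hcm t ht)).2.2
            · exact hGη t ht
          _ = _ := by ring
      calc _ ≤ _ := norm_add_le _ _
        _ ≤ K ^ 3 * ‖η‖ ^ 2 + K ^ 2 * ‖η‖ ^ 2 := add_le_add i1 i2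
        _ = _ := by ring
    -- Grönwall: `γ (ξ + η)` is an exact solution, `w` an approximate one, and both start at `y₀`.
    have := dist_le_of_approx_trajectories_ODE_of_mem (v := fun _ y ↦ G y (ξ + η)) (K := K)
      (s := fun _ ↦ closedBall y₀ R) (f := γ (ξ + η)) (g := w) (a := 0) (b := 1) (δ := 0) (εf := 0)
      (fun _ _ ↦ hLξ _ hη) (hcont _ hη)
      (fun t ht ↦ hright ht (hγ _ hη t (Ico_subset_Icc_self ht)).2) (by simp)
      (fun t ht ↦ hsub' (hγ _ hη t (Ico_subset_Icc_self ht)).1)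
      (fun t ht ↦ (hw' t ht).continuousWithinAt)
      (fun t ht ↦ hright ht (hw' t (Ico_subset_Icc_self ht))) hbound
      (fun t ht ↦ hwm t (Ico_subset_Icc_self ht)) (by simp [hw, hc, hγ0]) 1 h01
    simpa [dist_eq_norm, hw, sub_sub] using this
  -- With zero initial distance the bound is linear in the defect; `K = 0` is separate because the
  -- general formula divides by `K`.
  obtain ⟨C, hC⟩ : ∃ C : ℝ, ∀ ε, gronwallBound 0 K ε 1 = C * ε := by
    by_cases h : (K : ℝ) = 0
    · exact ⟨1, fun ε ↦ by simp [h, gronwallBound_K0]⟩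
    · exact ⟨(K : ℝ)⁻¹ * (Real.exp K - 1), fun ε ↦ by
        simp only [gronwallBound_of_K_ne_0 h, mul_one, zero_mul, zero_add]; ring⟩
  rw [hasFDerivAt_iff_isLittleO_nhds_zero]
  refine (Asymptotics.IsBigO.of_bound (C * (K ^ 3 + K ^ 2)) ?_ :
    _ =O[𝓝 0] fun η : F ↦ ‖η‖ ^ 2).trans_isLittleO ?_
  · filter_upwards [key] with η hη
    rw [hC] at hη
    simpa [mul_assoc] using hη
  · simpa using Asymptotics.isLittleO_norm_pow_id (E' := F) one_lt_two

/-- A map `φ` with differential `G ∘ φ`, where `G` is of class `C^∞`, is of class `C^∞`. -/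
theorem contDiffOn_of_hasFDerivAt {G : E → F →L[ℝ] E} {s : Set E} (hG : ContDiffOn ℝ ∞ G s)
    {φ : F → E} {U : Set F} (hU : IsOpen U)
    (hφ : ∀ ξ ∈ U, φ ξ ∈ s ∧ HasFDerivAt φ (G (φ ξ)) ξ) : ContDiffOn ℝ ∞ φ U := by
  rw [contDiffOn_infty]
  intro k
  -- Bootstrap: if `φ` is `C^k`, so is its derivative `G ∘ φ`, hence `φ` is `C^(k+1)`.
  induction k with
  | zero => exact contDiffOn_zero.2 fun ξ hξ ↦ (hφ ξ hξ).2.continuousAt.continuousWithinAt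
  | succ k ih =>
    have : ContDiffOn ℝ k (fun ξ ↦ G (φ ξ)) U :=
      (hG.of_le (by exact_mod_cast le_top)).comp ih fun ξ hξ ↦ (hφ ξ hξ).1
    rw [Nat.cast_succ, contDiffOn_succ_iff_fderiv_of_isOpen hU]
    exact ⟨fun ξ hξ ↦ (hφ ξ hξ).2.differentiableAt.differentiableWithinAt, by simp,
      this.congr fun ξ hξ ↦ (hφ ξ hξ).2.fderiv⟩

/-- Frobenius' theorem for a smooth field `G` of operators with commuting columns, and a common left
inverse `B`: through `y₀` there passes an integral manifold of the field of the ranges. -/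
theorem exists_injOn_contDiffOn_hasFDerivAt [CompleteSpace E] {G : E → F →L[ℝ] E} {y₀ : E}
    {s : Set E} (hs : IsOpen s) (hy₀ : y₀ ∈ s) (hG : ContDiffOn ℝ ∞ G s)
    {B : E →L[ℝ] F} (hB : ∀ y ∈ s, ∀ ξ, B (G y ξ) = ξ)
    (hsymm : ∀ y ∈ s, ∀ ξ η, fderiv ℝ G y (G y ξ) η = fderiv ℝ G y (G y η) ξ) :
    ∃ (U : Set F) (φ : F → E), IsOpen U ∧ 0 ∈ U ∧ φ 0 = y₀ ∧ InjOn φ U ∧ ContDiffOn ℝ ∞ φ U ∧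
      ∀ ξ ∈ U, φ ξ ∈ s ∧ HasFDerivAt φ (G (φ ξ)) ξ := by
  obtain ⟨δ, hδ, φ, h0, h⟩ := exists_hasFDerivAt_of_symm (hG.contDiffAt (hs.mem_nhds hy₀))
    (hs.mem_nhds hy₀) hsymm
  refine ⟨ball 0 δ, φ, isOpen_ball, mem_ball_self hδ, h0, ?_,
    contDiffOn_of_hasFDerivAt hG isOpen_ball h, h⟩
  -- Injectivity: `Bφ(ξ) - ξ` has derivative `BG - id = 0`, so it is constant on the ball.
  have hd : ∀ ξ ∈ ball (0 : F) δ,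
      HasFDerivWithinAt (fun ξ ↦ B (φ ξ) - ξ) (0 : F →L[ℝ] F) (ball 0 δ) ξ := by
    intro ξ hξ
    have h1 := ((B.hasFDerivAt.comp ξ (h ξ hξ).2).sub (hasFDerivAt_id ξ)).hasFDerivWithinAt
      (s := ball 0 δ)
    have h2 : B ∘L G (φ ξ) - ContinuousLinearMap.id ℝ F = 0 := by
      ext η
      simp [hB _ (h ξ hξ).1]
    rw [h2] at h1
    exact h1
  intro ξ hξ η hη hφ
  have := (convex_ball (0 : F) δ).norm_image_sub_le_of_norm_hasFDerivWithin_le (C := 0) hd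
    (by simp) hξ hη
  simp only [hφ, zero_mul, norm_le_zero_iff] at this
  have h2 : ξ - η = 0 := by rw [← this]; abel
  exact sub_eq_zero.1 h2

end Frobenius

/-! ### Derivatives of vector-valued functions and Lie brackets -/

section Bracket

open Filter Topology VectorField

variable {m : ℕ} {N : Type*} [TopologicalSpace N]
  [ChartedSpace (EuclideanSpace ℝ (Fin m)) N] [IsManifold (𝓡 m) ∞ N]
  {F : Type*} [NormedAddCommGroup F] [NormedSpace ℝ F]

/-- The chain rule for the derivative of a function with values in a vector space. -/
theorem mvfderiv_comp_apply' {E H E' H' X Y : Type*} [NormedAddCommGroup E] [NormedSpace ℝ E]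
    [TopologicalSpace H] {I : ModelWithCorners ℝ E H} [TopologicalSpace X] [ChartedSpace H X]
    [NormedAddCommGroup E'] [NormedSpace ℝ E'] [TopologicalSpace H'] {J : ModelWithCorners ℝ E' H'}
    [TopologicalSpace Y] [ChartedSpace H' Y] {g : Y → F} {f : X → Y} {x : X}
    (hg : MDifferentiableAt J 𝓘(ℝ, F) g (f x)) (hf : MDifferentiableAt I J f x)
    (v : TangentSpace I x) :
    mvfderiv I (fun y ↦ g (f y)) x v = mvfderiv J g (f x) (mfderiv I J f x v) :=
  mfderiv_comp_apply x hg hf v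

theorem mvfderiv_congr {E H X : Type*} [NormedAddCommGroup E] [NormedSpace ℝ E]
    [TopologicalSpace H] {I : ModelWithCorners ℝ E H} [TopologicalSpace X] [ChartedSpace H X]
    {g h : X → F} {x : X} (hgh : g =ᶠ[𝓝 x] h) (v : TangentSpace I x) :
    mvfderiv I g x v = mvfderiv I h x v := by
  have := hgh.mfderiv_eq (I := I) (I' := 𝓘(ℝ, F))
  exact congrArg (fun A : E →L[ℝ] F ↦ A v) this

theorem mvfderiv_vectorSpace {E : Type*} [NormedAddCommGroup E] [NormedSpace ℝ E] (g : E → F)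
    (x v : E) : mvfderiv 𝓘(ℝ, E) g x v = fderiv ℝ g x v := by
  have := mfderiv_eq_fderiv (𝕜 := ℝ) (f := g) (x := x)
  exact congrArg (fun A : E →L[ℝ] F ↦ A v) this

theorem fderiv_comp_apply_mfderiv {E E' H' Y : Type*} [NormedAddCommGroup E] [NormedSpace ℝ E]
    [NormedAddCommGroup E'] [NormedSpace ℝ E'] [TopologicalSpace H'] {J : ModelWithCorners ℝ E' H'}
    [TopologicalSpace Y] [ChartedSpace H' Y] {g : Y → F} {f : E → Y} {x : E}
    (hg : MDifferentiableAt J 𝓘(ℝ, F) g (f x)) (hf : MDifferentiableAt 𝓘(ℝ, E) J f x) (v : E) :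
    fderiv ℝ (fun y ↦ g (f y)) x v = mvfderiv J g (f x) (mfderiv 𝓘(ℝ, E) J f x v) :=
  (mvfderiv_vectorSpace _ _ _).symm.trans (mvfderiv_comp_apply' hg hf v)

/-- The components of the field `W` in the chart at `x`. -/
def chartField (x : N) (W : Π x : N, TangentSpace (𝓡 m) x) (z : EuclideanSpace ℝ (Fin m)) :
    EuclideanSpace ℝ (Fin m) :=
  mpullbackWithin 𝓘(ℝ, EuclideanSpace ℝ (Fin m)) (𝓡 m) (extChartAt (𝓡 m) x).symm W (range (𝓡 m)) z

theorem eventually_mdifferentiableAt {h : N → F} {x : N}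
    (hh : ContMDiffAt (𝓡 m) 𝓘(ℝ, F) ∞ h x) :
    ∀ᶠ y in 𝓝 x, MDifferentiableAt (𝓡 m) 𝓘(ℝ, F) h y := by
  have h1 : ContMDiffAt (𝓡 m) 𝓘(ℝ, F) 1 h x := hh.of_le (by norm_cast)
  have h2 := (contMDiffAt_iff_contMDiffAt_nhds (I := 𝓡 m) (I' := 𝓘(ℝ, F)) (n := 1)
    (by simp)).1 h1
  filter_upwards [h2] with y hy using ContMDiffAt.mdifferentiableAt hy one_ne_zero

/-- The derivative of a function in the direction of a field `W`, near `x`, in the chart at `x`. -/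
theorem eventually_fderiv_chartField {h : N → F} {x : N}
    (hh : ContMDiffAt (𝓡 m) 𝓘(ℝ, F) ∞ h x) (W : Π x : N, TangentSpace (𝓡 m) x) :
    ∀ᶠ y in 𝓝 x, mvfderiv (𝓡 m) h y (W y)
      = fderiv ℝ (fun z ↦ h ((extChartAt (𝓡 m) x).symm z)) (extChartAt (𝓡 m) x y)
        (chartField x W (extChartAt (𝓡 m) x y)) := by
  filter_upwards [eventually_mdifferentiableAt hh, extChartAt_source_mem_nhds (I := 𝓡 m) x]
    with y hy hys
  set φ := extChartAt (𝓡 m) x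
  have hz : φ y ∈ φ.target := φ.map_source hys
  have hinv : φ.symm (φ y) = y := φ.left_inv hys
  have key : mvfderiv (𝓡 m) h (φ.symm (φ y)) (W (φ.symm (φ y)))
      = fderiv ℝ (fun z ↦ h (φ.symm z)) (φ y) (chartField x W (φ y)) := by
    have hI := isInvertible_mfderivWithin_extChartAt_symm (I := 𝓡 m) hz
    have h3 : mfderivWithin 𝓘(ℝ, EuclideanSpace ℝ (Fin m)) (𝓡 m) φ.symm (range (𝓡 m)) (φ y)
        = mfderiv 𝓘(ℝ, EuclideanSpace ℝ (Fin m)) (𝓡 m) φ.symm (φ y) := by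
      simp only [modelWithCornersSelf_coe, range_id, mfderivWithin_univ]
    have hd : MDifferentiableAt 𝓘(ℝ, EuclideanSpace ℝ (Fin m)) (𝓡 m) φ.symm (φ y) := by
      have := mdifferentiableWithinAt_extChartAt_symm (I := 𝓡 m) hz
      simp only [modelWithCornersSelf_coe, range_id, mdifferentiableWithinAt_univ] at this
      exact this
    refine Eq.trans ?_ (fderiv_comp_apply_mfderiv (by rw [hinv]; exact hy) hd _).symm
    refine congrArg (mvfderiv (𝓡 m) h (φ.symm (φ y))) ?_
    rw [← h3]
    exact (hI.self_apply_inverse _).symm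
  rw [← key, hinv]

theorem contDiffAt_comp_extChartAt_symm {h : N → F} {x : N}
    (hh : ContMDiffAt (𝓡 m) 𝓘(ℝ, F) ∞ h x) :
    ContDiffAt ℝ ∞ (fun z ↦ h ((extChartAt (𝓡 m) x).symm z)) (extChartAt (𝓡 m) x x) := by
  have := (contMDiffAt_iff.1 hh).2
  simp only [modelWithCornersSelf_coe, range_id, contDiffWithinAt_univ] at this
  exact this

theorem differentiableAt_chartField {x : N} {W : Π x : N, TangentSpace (𝓡 m) x}
    (hW : MDifferentiableAt (𝓡 m) (𝓡 m).tangent (fun y ↦ (⟨y, W y⟩ : TangentBundle (𝓡 m) N)) x) :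
    DifferentiableAt ℝ (chartField x W) (extChartAt (𝓡 m) x x) := by
  have := (MDifferentiableAt.mdifferentiableWithinAt
    (s := univ) hW).differentiableWithinAt_mpullbackWithin_vectorField
  simp only [preimage_univ, univ_inter] at this
  exact this.differentiableAt (by simp)

theorem mvfderiv_eq_fderiv {h : N → F} {x : N} (hh : MDifferentiableAt (𝓡 m) 𝓘(ℝ, F) h x)
    (v : TangentSpace (𝓡 m) x) : mvfderiv (𝓡 m) h x v
      = fderiv ℝ (fun z ↦ h ((extChartAt (𝓡 m) x).symm z)) (extChartAt (𝓡 m) x x) v := by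
  have := hh.mvfderiv
  simp only [modelWithCornersSelf_coe, range_id, fderivWithin_univ] at this
  exact congrArg (fun A : EuclideanSpace ℝ (Fin m) →L[ℝ] F ↦ A v) this

theorem chartField_self (x : N) (W : Π x : N, TangentSpace (𝓡 m) x) :
    chartField x W (extChartAt (𝓡 m) x x) = W x := by
  have key : ∀ y, y = x → (mfderivWithin 𝓘(ℝ, EuclideanSpace ℝ (Fin m)) (𝓡 m)
      (extChartAt (𝓡 m) x).symm (range (𝓡 m)) (extChartAt (𝓡 m) x x)).inverse
        (W y : EuclideanSpace ℝ (Fin m)) = (W x : EuclideanSpace ℝ (Fin m)) := by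
    rintro y rfl
    exact mfderivWithin_extChartAt_symm_inverse_apply (I := 𝓡 m) (W y)
  exact key _ (extChartAt_to_inv x)

/-- The bracket is defined by transport from the chart at `x`, whose differential at its own centre
is the identity. -/
theorem mlieBracket_eq_lieBracket (x : N) (U W : Π x : N, TangentSpace (𝓡 m) x) :
    mlieBracket (𝓡 m) U W x
      = lieBracket ℝ (chartField x U) (chartField x W) (extChartAt (𝓡 m) x x) := by
  have h1 := mlieBracketWithin_apply (I := 𝓡 m) (V := U) (W := W) (s := univ) (x₀ := x)
  rw [mlieBracketWithin_univ, mfderiv_extChartAt_self, preimage_univ, univ_inter] at h1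
  refine h1.trans ?_
  have h2 : lieBracketWithin ℝ (chartField x U) (chartField x W) (range (𝓡 m))
      = lieBracket ℝ (chartField x U) (chartField x W) := by
    simp only [modelWithCornersSelf_coe, range_id, lieBracketWithin_univ]
  rw [← h2]
  exact congrArg (fun A : EuclideanSpace ℝ (Fin m) →L[ℝ] EuclideanSpace ℝ (Fin m) ↦
    A (lieBracketWithin ℝ (chartField x U) (chartField x W) (range (𝓡 m)) (extChartAt (𝓡 m) x x)))
    (ContinuousLinearMap.inverse_id (R := ℝ) (M := EuclideanSpace ℝ (Fin m)))

theorem mdifferentiableAt_fderiv_chartField {h : N → F} {x : N}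
    (hh : ContMDiffAt (𝓡 m) 𝓘(ℝ, F) ∞ h x) {W : Π x : N, TangentSpace (𝓡 m) x}
    (hW : MDifferentiableAt (𝓡 m) (𝓡 m).tangent (fun y ↦ (⟨y, W y⟩ : TangentBundle (𝓡 m) N)) x) :
    DifferentiableAt ℝ (fun z ↦ fderiv ℝ (fun z ↦ h ((extChartAt (𝓡 m) x).symm z)) z
      (chartField x W z)) (extChartAt (𝓡 m) x x) :=
  (((contDiffAt_comp_extChartAt_symm hh).fderiv_right (m := 1) (by norm_cast)).differentiableAt
    one_ne_zero).clm_apply (differentiableAt_chartField hW)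

/-- The derivative of `h` in the direction of a differentiable field is differentiable. -/
theorem mdifferentiableAt_mvfderiv_apply {h : N → F} {x : N}
    (hh : ContMDiffAt (𝓡 m) 𝓘(ℝ, F) ∞ h x) {W : Π x : N, TangentSpace (𝓡 m) x}
    (hW : MDifferentiableAt (𝓡 m) (𝓡 m).tangent (fun y ↦ (⟨y, W y⟩ : TangentBundle (𝓡 m) N)) x) :
    MDifferentiableAt (𝓡 m) 𝓘(ℝ, F) (fun y ↦ mvfderiv (𝓡 m) h y (W y)) x :=
  ((mdifferentiableAt_fderiv_chartField hh hW).mdifferentiableAt.comp x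
    (mdifferentiableAt_extChartAt (mem_chart_source _ x))).congr_of_eventuallyEq
      (eventually_fderiv_chartField hh W)

theorem mvfderiv_mvfderiv_apply {h : N → F} {x : N}
    (hh : ContMDiffAt (𝓡 m) 𝓘(ℝ, F) ∞ h x) {W : Π x : N, TangentSpace (𝓡 m) x}
    (hW : MDifferentiableAt (𝓡 m) (𝓡 m).tangent (fun y ↦ (⟨y, W y⟩ : TangentBundle (𝓡 m) N)) x)
    (v : TangentSpace (𝓡 m) x) :
    mvfderiv (𝓡 m) (fun y ↦ mvfderiv (𝓡 m) h y (W y)) x v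
      = fderiv ℝ (fun z ↦ fderiv ℝ (fun z ↦ h ((extChartAt (𝓡 m) x).symm z)) z
        (chartField x W z)) (extChartAt (𝓡 m) x x) v := by
  rw [mvfderiv_congr (eventually_fderiv_chartField hh W),
    mvfderiv_comp_apply' (f := extChartAt (𝓡 m) x)
      (mdifferentiableAt_fderiv_chartField hh hW).mdifferentiableAt
      (mdifferentiableAt_extChartAt (mem_chart_source _ x)), mfderiv_extChartAt_self]
  exact mvfderiv_vectorSpace _ _ _

/-- The derivative in the direction of a Lie bracket is the commutator of the derivatives. -/
theorem mvfderiv_mlieBracket {h : N → F} {x : N}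
    (hh : ContMDiffAt (𝓡 m) 𝓘(ℝ, F) ∞ h x) {U W : Π x : N, TangentSpace (𝓡 m) x}
    (hU : MDifferentiableAt (𝓡 m) (𝓡 m).tangent (fun y ↦ (⟨y, U y⟩ : TangentBundle (𝓡 m) N)) x)
    (hW : MDifferentiableAt (𝓡 m) (𝓡 m).tangent (fun y ↦ (⟨y, W y⟩ : TangentBundle (𝓡 m) N)) x) :
    mvfderiv (𝓡 m) h x (mlieBracket (𝓡 m) U W x)
      = mvfderiv (𝓡 m) (fun y ↦ mvfderiv (𝓡 m) h y (W y)) x (U x)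
        - mvfderiv (𝓡 m) (fun y ↦ mvfderiv (𝓡 m) h y (U y)) x (W x) := by
  -- Everything is moved to the chart at `x`, where the identity is the vector space one.
  rw [mvfderiv_mvfderiv_apply hh hW, mvfderiv_mvfderiv_apply hh hU,
    mvfderiv_eq_fderiv (hh.mdifferentiableAt (by simp)), mlieBracket_eq_lieBracket,
    fderiv_apply_lieBracket (contDiffAt_comp_extChartAt_symm hh)
      (by rw [minSmoothness_of_isRCLikeNormedField]; norm_cast)
      (differentiableAt_chartField hW) (differentiableAt_chartField hU),
    chartField_self, chartField_self]

end Bracket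

/-! ### The connection along a map -/

section Connection

open Filter Topology VectorField

variable {m n : ℕ} {N M : Type*}
  [TopologicalSpace N] [ChartedSpace (EuclideanSpace ℝ (Fin m)) N] [IsManifold (𝓡 m) ∞ N]
  [TopologicalSpace M] [ChartedSpace (EuclideanSpace ℝ (Fin n)) M] [IsManifold (𝓡 n) ∞ M]

variable (n) in
/-- The trivialization of `TM` at `p`. -/
abbrev triv (p : M) : Trivialization (EuclideanSpace ℝ (Fin n))
    (π (EuclideanSpace ℝ (Fin n)) (TangentSpace (𝓡 n) : M → Type _)) :=
  trivializationAt (EuclideanSpace ℝ (Fin n)) (TangentSpace (𝓡 n) : M → Type _) p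

/-- Turns bundle components into derivatives of the coordinate map, so that `mvfderiv_mlieBracket`
can compute brackets. -/
theorem triv_apply_snd {p q : M} (hq : q ∈ (chartAt (EuclideanSpace ℝ (Fin n)) p).source)
    (v : TangentSpace (𝓡 n) q) :
    (triv n p ⟨q, v⟩).2 = mvfderiv (𝓡 n) (extChartAt (𝓡 n) p) q v := by
  have h1 := TangentBundle.continuousLinearMapAt_trivializationAt (I := 𝓡 n) hq
  have h2 : (triv n p).continuousLinearMapAt ℝ q v = (triv n p ⟨q, v⟩).2 :=
    Trivialization.continuousLinearMapAt_apply_of_mem ℝ (triv n p) (by simpa using hq) v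
  rw [← h2]
  exact congrArg (fun A : EuclideanSpace ℝ (Fin n) →L[ℝ] EuclideanSpace ℝ (Fin n) ↦ A v) h1

theorem symmL_triv_apply_snd_of_mem {p q : M} (hq : q ∈ (triv n p).baseSet)
    (v : TangentSpace (𝓡 n) q) : (triv n p).symmL ℝ q (triv n p ⟨q, v⟩).2 = v := by
  rw [← Trivialization.continuousLinearMapAt_apply_of_mem ℝ (triv n p) hq v]
  exact Trivialization.symmL_continuousLinearMapAt (triv n p) hq v

theorem symmL_triv_apply_snd (p : M) (v : TangentSpace (𝓡 n) p) :
    (triv n p).symmL ℝ p (triv n p ⟨p, v⟩).2 = v :=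
  symmL_triv_apply_snd_of_mem (FiberBundle.mem_baseSet_trivializationAt' p) v

theorem eventually_triv_extend (p : M) (v : TangentSpace (𝓡 n) p) :
    ∀ᶠ q in 𝓝 p, (triv n p ⟨q, FiberBundle.extend (EuclideanSpace ℝ (Fin n)) v q⟩).2
      = (triv n p ⟨p, v⟩).2 := by
  filter_upwards [(triv n p).open_baseSet.mem_nhds (FiberBundle.mem_baseSet_trivializationAt' p)]
    with q hq
  simp only [FiberBundle.extend]
  rw [Trivialization.apply_mk_symm _ hq]

theorem mdifferentiableAt_extend' (p : M) (v : TangentSpace (𝓡 n) p) :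
    MDifferentiableAt (𝓡 n) (𝓡 n).tangent (fun q ↦ (⟨q,
      FiberBundle.extend (EuclideanSpace ℝ (Fin n)) v q⟩ : TangentBundle (𝓡 n) M)) p :=
  FiberBundle.mdifferentiableAt_extend (𝓡 n) (EuclideanSpace ℝ (Fin n)) v

/-- Fields with constant components in a chart commute at the centre of the chart. -/
theorem mlieBracket_extend (p : M) (v w : TangentSpace (𝓡 n) p) :
    mlieBracket (𝓡 n) (FiberBundle.extend (EuclideanSpace ℝ (Fin n)) v)
      (FiberBundle.extend (EuclideanSpace ℝ (Fin n)) w) p = 0 := by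
  have hp := mem_chart_source (EuclideanSpace ℝ (Fin n)) p
  -- Along such a field the coordinates have constant derivative near `p`, so the second derivatives
  -- vanish.
  have hc : ∀ u : TangentSpace (𝓡 n) p, ∀ X, mvfderiv (𝓡 n) (fun q ↦ mvfderiv (𝓡 n)
      (extChartAt (𝓡 n) p) q (FiberBundle.extend (EuclideanSpace ℝ (Fin n)) u q)) p X = 0 := by
    intro u X
    rw [mvfderiv_congr (h := fun _ ↦ (triv n p ⟨p, u⟩).2), mvfderiv_const]
    · rfl
    · filter_upwards [eventually_triv_extend p u,
        (chartAt (EuclideanSpace ℝ (Fin n)) p).open_source.mem_nhds hp] with q h1 h2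
      rw [← h1, triv_apply_snd h2]
  have h := mvfderiv_mlieBracket (contMDiffAt_extChartAt (I := 𝓡 n) (n := ∞) (x := p))
    (mdifferentiableAt_extend' p v) (mdifferentiableAt_extend' p w)
  rw [hc, hc, sub_zero, ← triv_apply_snd hp] at h
  rw [← symmL_triv_apply_snd p (mlieBracket (𝓡 n) _ _ p), h, map_zero]

variable (cov : CovariantDerivative (𝓡 n) (EuclideanSpace ℝ (Fin n))
      (fun p : M ↦ TangentSpace (𝓡 n) p))

/-- Symmetry of the Christoffel symbols: the two extensions commute at `p`. -/
theorem cov_extend_symm (hcov : cov.torsion = 0) (p : M) (v w : TangentSpace (𝓡 n) p) :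
    cov (FiberBundle.extend (EuclideanSpace ℝ (Fin n)) w) p v
      = cov (FiberBundle.extend (EuclideanSpace ℝ (Fin n)) v) p w := by
  have h := cov.torsion_eq_zero_iff.1 hcov (mdifferentiableAt_extend' p v)
    (mdifferentiableAt_extend' p w)
  rw [mlieBracket_extend, FiberBundle.extend_apply_self, FiberBundle.extend_apply_self] at h
  exact sub_eq_zero.1 h

theorem eventually_triv_differential {f : N → M} {x : N} (hf : ContMDiffAt (𝓡 m) (𝓡 n) ∞ f x)
    (W : Π x : N, TangentSpace (𝓡 m) x) :
    ∀ᶠ y in 𝓝 x, (triv n (f x) ⟨f y, differential f y (W y)⟩).2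
      = mvfderiv (𝓡 m) (fun y ↦ extChartAt (𝓡 n) (f x) (f y)) y (W y) := by
  have h1 : ∀ᶠ y in 𝓝 x, MDifferentiableAt (𝓡 m) (𝓡 n) f y := by
    have h2 := (contMDiffAt_iff_contMDiffAt_nhds (I := 𝓡 m) (I' := 𝓡 n) (n := 1)
      (by simp)).1 (hf.of_le (by norm_cast))
    filter_upwards [h2] with y hy using ContMDiffAt.mdifferentiableAt hy one_ne_zero
  filter_upwards [h1, hf.continuousAt.preimage_mem_nhds
    ((chartAt (EuclideanSpace ℝ (Fin n)) (f x)).open_source.mem_nhds (mem_chart_source _ (f x)))]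
    with y hy hys
  rw [triv_apply_snd hys]
  exact (mvfderiv_comp_apply' (mdifferentiableAt_extChartAt hys) hy (W y)).symm

theorem contMDiffAt_extChartAt_comp {f : N → M} {x : N} (hf : ContMDiffAt (𝓡 m) (𝓡 n) ∞ f x) :
    ContMDiffAt (𝓡 m) 𝓘(ℝ, EuclideanSpace ℝ (Fin n)) ∞
      (fun y ↦ extChartAt (𝓡 n) (f x) (f y)) x :=
  (contMDiffAt_extChartAt (I := 𝓡 n) (n := ∞) (x := f x)).comp x hf

/-- A torsion-free connection along a map: `∇_U (df W) - ∇_W (df U) = df [U, W]`. -/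
theorem covAlong_differential_sub (hcov : cov.torsion = 0) {f : N → M} {x : N}
    (hf : ContMDiffAt (𝓡 m) (𝓡 n) ∞ f x) {U W : Π x : N, TangentSpace (𝓡 m) x}
    (hU : MDifferentiableAt (𝓡 m) (𝓡 m).tangent (fun y ↦ (⟨y, U y⟩ : TangentBundle (𝓡 m) N)) x)
    (hW : MDifferentiableAt (𝓡 m) (𝓡 m).tangent (fun y ↦ (⟨y, W y⟩ : TangentBundle (𝓡 m) N)) x) :
    covAlong cov f (fun y ↦ differential f y (W y)) x (U x)
      - covAlong cov f (fun y ↦ differential f y (U y)) x (W x)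
      = differential f x (mlieBracket (𝓡 m) U W x) := by
  have hb := mvfderiv_mlieBracket (contMDiffAt_extChartAt_comp hf) hU hW
  have hx := (eventually_triv_differential hf (mlieBracket (𝓡 m) U W)).self_of_nhds
  -- The Christoffel terms cancel; what remains is the commutator of derivatives of the coordinates
  -- of `f`, that is, their derivative along `[U, W]`.
  rw [covAlong, covAlong, cov_extend_symm cov hcov (f x) (differential f x (U x)),
    add_sub_add_right_eq_sub, ← map_sub, mvfderiv_congr (eventually_triv_differential hf W),
    mvfderiv_congr (eventually_triv_differential hf U), ← hb, ← hx, symmL_triv_apply_snd]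

/-- The covariant derivative in the bundle chart at `p`. -/
theorem cov_eq_add_cov_extend {p : M} {Z : Π q : M, TangentSpace (𝓡 n) q}
    (hZ : MDifferentiableAt (𝓡 n) (𝓡 n).tangent (fun q ↦ (⟨q, Z q⟩ : TangentBundle (𝓡 n) M)) p)
    (X : TangentSpace (𝓡 n) p) :
    cov Z p X = (triv n p).symmL ℝ p (mvfderiv (𝓡 n) (fun q ↦ (triv n p ⟨q, Z q⟩).2) p X)
      + cov (FiberBundle.extend (EuclideanSpace ℝ (Fin n)) (Z p)) p X := by
  have hmd : ∀ {σ : Π q : M, TangentSpace (𝓡 n) q},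
      MDifferentiableAt (𝓡 n) (𝓡 n).tangent (fun q ↦ (⟨q, σ q⟩ : TangentBundle (𝓡 n) M)) p →
      MDifferentiableAt (𝓡 n) 𝓘(ℝ, EuclideanSpace ℝ (Fin n)) (fun q ↦ (triv n p ⟨q, σ q⟩).2) p :=
    fun hσ ↦ (mdifferentiableAt_section (IB := 𝓡 n) (F := EuclideanSpace ℝ (Fin n)) _).1 hσ
  have hbase : ∀ᶠ q in 𝓝 p, q ∈ (triv n p).baseSet :=
    (triv n p).open_baseSet.mem_nhds (FiberBundle.mem_baseSet_trivializationAt' p)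
  -- Differentiation of components is a flat connection. Its difference from `cov` is tensorial, so
  -- at `p` it takes the same value on `Z` and on the constant-component extension of `Z p`, which
  -- is flat.
  have hflat : IsCovariantDerivativeOn (EuclideanSpace ℝ (Fin n)) (I := 𝓡 n)
      (fun (σ : Π q : M, TangentSpace (𝓡 n) q) (q : M) ↦ (triv n p).symmL ℝ q ∘L
        mvfderiv (𝓡 n) (fun q ↦ (triv n p ⟨q, σ q⟩).2) q) {p} := by
    constructor
    · rintro σ σ' q hσ hσ' rfl
      ext v
      have h1 : (fun x ↦ (triv n q ⟨x, (σ + σ') x⟩).2) =ᶠ[𝓝 q]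
          (fun x ↦ (triv n q ⟨x, σ x⟩).2) + fun x ↦ (triv n q ⟨x, σ' x⟩).2 := by
        filter_upwards [hbase] with x hx
        exact ((triv n q).linear ℝ hx).map_add _ _
      have h2 : mvfderiv (𝓡 n) (fun x ↦ (triv n q ⟨x, (σ + σ') x⟩).2) q v
          = mvfderiv (𝓡 n) (fun x ↦ (triv n q ⟨x, σ x⟩).2) q v
            + mvfderiv (𝓡 n) (fun x ↦ (triv n q ⟨x, σ' x⟩).2) q v := by
        rw [mvfderiv_congr h1, mvfderiv_add (hmd hσ) (hmd hσ')]
        rfl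
      exact (congrArg ((triv n q).symmL ℝ q) h2).trans (map_add _ _ _)
    · rintro σ a q hσ ha rfl
      ext v
      have h1 : (fun x ↦ (triv n q ⟨x, (a • σ) x⟩).2) =ᶠ[𝓝 q]
          a • (fun x ↦ (triv n q ⟨x, σ x⟩).2) := by
        filter_upwards [hbase] with x hx
        exact ((triv n q).linear ℝ hx).map_smul _ _
      have h2 : mvfderiv (𝓡 n) (fun x ↦ (triv n q ⟨x, (a • σ) x⟩).2) q v
          = a q • mvfderiv (𝓡 n) (fun x ↦ (triv n q ⟨x, σ x⟩).2) q v
            + mvfderiv (𝓡 n) a q v • (triv n q ⟨q, σ q⟩).2 := by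
        rw [mvfderiv_congr h1, mvfderiv_smul ha (hmd hσ)]
        rfl
      refine (congrArg ((triv n q).symmL ℝ q) h2).trans ?_
      rw [map_add, map_smul, map_smul, symmL_triv_apply_snd]
      rfl
  have hd := fun {σ : Π q : M, TangentSpace (𝓡 n) q} (hσ) ↦
    IsCovariantDerivativeOn.difference_apply (I := 𝓡 n) (F := EuclideanSpace ℝ (Fin n))
      (cov.isCovariantDerivativeOn (s := {p})) hflat (x := p) rfl (σ := σ) hσ
  have h1 := hd hZ
  have h2 := hd (mdifferentiableAt_extend' p (Z p))
  rw [FiberBundle.extend_apply_self, h1] at h2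
  have h3 := congrArg (fun A : TangentSpace (𝓡 n) p →L[ℝ] TangentSpace (𝓡 n) p ↦ A X) h2
  have h4 : mvfderiv (𝓡 n) (fun q ↦ (triv n p ⟨q,
      FiberBundle.extend (EuclideanSpace ℝ (Fin n)) (Z p) q⟩).2) p X = 0 := by
    rw [mvfderiv_congr (eventually_triv_extend p (Z p)), mvfderiv_const]
    rfl
  simp only [sub_apply, ContinuousLinearMap.comp_apply, h4, map_zero, sub_zero] at h3
  rw [← h3]
  abel

theorem mvfderiv_clm_apply {F F' : Type*} [NormedAddCommGroup F] [NormedSpace ℝ F]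
    [NormedAddCommGroup F'] [NormedSpace ℝ F'] {A : N → F →L[ℝ] F'} {h : N → F} {x : N}
    (hA : MDifferentiableAt (𝓡 m) 𝓘(ℝ, F →L[ℝ] F') A x)
    (hh : MDifferentiableAt (𝓡 m) 𝓘(ℝ, F) h x) (u : TangentSpace (𝓡 m) x) :
    mvfderiv (𝓡 m) (fun y ↦ A y (h y)) x u
      = A x (mvfderiv (𝓡 m) h x u) + mvfderiv (𝓡 m) A x u (h x) := by
  have hA' := hA.differentiableWithinAt_writtenInExtChartAt
  have hh' := hh.differentiableWithinAt_writtenInExtChartAt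
  simp only [modelWithCornersSelf_coe, range_id, differentiableWithinAt_univ] at hA' hh'
  have hx := extChartAt_to_inv (I := 𝓡 m) x
  rw [mvfderiv_eq_fderiv (hA.clm_apply hh), mvfderiv_eq_fderiv hA, mvfderiv_eq_fderiv hh]
  have := congrArg (fun B : EuclideanSpace ℝ (Fin m) →L[ℝ] F' ↦ B u) (fderiv_clm_apply hA' hh')
  simp only [Function.comp_apply, hx, writtenInExtChartAt, extChartAt_model_space_eq_id,
    PartialEquiv.refl_coe, id] at this
  exact this

variable {cov} {g : SemiRiemannianMetric n M} (P : GoldenStructure g)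

/-- The matrix of `P` in the bundle chart at `p`. -/
def GoldenStructure.inChart (p q : M) : EuclideanSpace ℝ (Fin n) →L[ℝ] EuclideanSpace ℝ (Fin n) :=
  ContinuousLinearMap.inCoordinates (EuclideanSpace ℝ (Fin n)) (TangentSpace (𝓡 n) : M → Type _)
    (EuclideanSpace ℝ (Fin n)) (TangentSpace (𝓡 n) : M → Type _) p q p q (P.val q)

theorem GoldenStructure.mdifferentiableAt_inChart (p : M) :
    MDifferentiableAt (𝓡 n) 𝓘(ℝ, EuclideanSpace ℝ (Fin n) →L[ℝ] EuclideanSpace ℝ (Fin n))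
      (P.inChart p) p :=
  ((contMDiffAt_hom_bundle _).1 (P.contMDiff p)).2.mdifferentiableAt (by simp)

theorem GoldenStructure.inChart_apply {p q : M} (hq : q ∈ (triv n p).baseSet)
    (v : TangentSpace (𝓡 n) q) :
    P.inChart p q (triv n p ⟨q, v⟩).2 = (triv n p ⟨q, P.val q v⟩).2 := by
  change (triv n p).continuousLinearMapAt ℝ q (P.val q ((triv n p).symmL ℝ q
    (triv n p ⟨q, v⟩).2)) = _
  rw [symmL_triv_apply_snd_of_mem hq]
  exact Trivialization.continuousLinearMapAt_apply_of_mem ℝ (triv n p) hq _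

/-- A parallel Golden structure commutes with the connection along a map. -/
theorem covAlong_golden (hP : P.IsLocallyGolden cov) {f : N → M} {x : N}
    (hf : MDifferentiableAt (𝓡 m) (𝓡 n) f x) {V : Π x : N, TangentSpace (𝓡 n) (f x)}
    (hV : MDifferentiableAt (𝓡 m) 𝓘(ℝ, EuclideanSpace ℝ (Fin n))
      (fun y ↦ (triv n (f x) ⟨f y, V y⟩).2) x) (u : TangentSpace (𝓡 m) x) :
    covAlong cov f (fun y ↦ P.val (f y) (V y)) x u = P.val (f x) (covAlong cov f V x u) := by
  have hbase : ∀ᶠ q in 𝓝 (f x), q ∈ (triv n (f x)).baseSet :=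
    (triv n (f x)).open_baseSet.mem_nhds (FiberBundle.mem_baseSet_trivializationAt' (f x))
  have hA := P.mdifferentiableAt_inChart (f x)
  have hsymm : ∀ w, (triv n (f x)).symmL ℝ (f x) (P.inChart (f x) (f x) w)
      = P.val (f x) ((triv n (f x)).symmL ℝ (f x) w) := by
    intro w
    have hw : (triv n (f x) ⟨f x, (triv n (f x)).symmL ℝ (f x) w⟩).2 = w := by
      rw [← Trivialization.continuousLinearMapAt_apply_of_mem ℝ _ hbase.self_of_nhds]
      exact Trivialization.continuousLinearMapAt_symmL _ hbase.self_of_nhds w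
    conv_lhs => rw [← hw, P.inChart_apply hbase.self_of_nhds]
    exact symmL_triv_apply_snd _ _
  -- the field with constant components
  have h1 : (fun q ↦ (triv n (f x) ⟨q, P.val q (FiberBundle.extend (EuclideanSpace ℝ (Fin n))
      (V x) q)⟩).2) =ᶠ[𝓝 (f x)] fun q ↦ P.inChart (f x) q (triv n (f x) ⟨f x, V x⟩).2 := by
    filter_upwards [hbase, eventually_triv_extend (f x) (V x)] with q h2 h3
    rw [← h3, P.inChart_apply h2]
  have hZ : MDifferentiableAt (𝓡 n) (𝓡 n).tangent (fun q ↦ (⟨q, P.val q (FiberBundle.extend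
      (EuclideanSpace ℝ (Fin n)) (V x) q)⟩ : TangentBundle (𝓡 n) M)) (f x) := by
    refine (mdifferentiableAt_section (IB := 𝓡 n) (F := EuclideanSpace ℝ (Fin n)) _).2 ?_
    exact (hA.clm_apply mdifferentiableAt_const).congr_of_eventuallyEq h1
  -- Parallelism speaks of fields on `M` only, so it is applied to the extension of `V x`. This
  -- expresses the derivative of the matrix of `P` through the Christoffel terms, and the product
  -- rule for `PV` needs just that.
  have h2 := cov_eq_add_cov_extend cov hZ (differential f x u)
  rw [hP _ _ (mdifferentiableAt_extend' (f x) (V x)), mvfderiv_congr h1,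
    mvfderiv_clm_apply hA mdifferentiableAt_const, mvfderiv_const,
    FiberBundle.extend_apply_self] at h2
  have h3 : (fun y ↦ (triv n (f x) ⟨f y, P.val (f y) (V y)⟩).2) =ᶠ[𝓝 x]
      fun y ↦ P.inChart (f x) (f y) (triv n (f x) ⟨f y, V y⟩).2 := by
    filter_upwards [hf.continuousAt.eventually hbase] with y hy
    rw [P.inChart_apply hy]
  rw [covAlong, covAlong, map_add, h2, mvfderiv_congr h3,
    mvfderiv_clm_apply (A := fun y ↦ P.inChart (f x) (f y)) (hA.comp x hf) hV, map_add, hsymm,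
    add_assoc, mvfderiv_comp_apply' hA hf]
  simp [differential]

end Connection

/-! ### Sections of the radical distribution of a transversal lightlike submanifold -/

section Radical

open Filter Topology VectorField

variable {m n r : ℕ} {N M : Type*}
  [TopologicalSpace N] [ChartedSpace (EuclideanSpace ℝ (Fin m)) N] [IsManifold (𝓡 m) ∞ N]
  [TopologicalSpace M] [ChartedSpace (EuclideanSpace ℝ (Fin n)) M] [IsManifold (𝓡 n) ∞ M]
  {g : SemiRiemannianMetric n M} {P : GoldenStructure g}
  {cov : CovariantDerivative (𝓡 n) (EuclideanSpace ℝ (Fin n)) (fun p : M ↦ TangentSpace (𝓡 n) p)}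
  {f : N → M} {S : LightlikeSubmanifold (m := m) g f r}

/-- `P(P - I) = I`, so `P` is injective. -/
theorem GoldenStructure.eq_zero_of_val_eq_zero (P : GoldenStructure g) {p : M}
    {v : TangentSpace (𝓡 n) p} (hv : P.val p v = 0) : v = 0 := by
  have := P.golden p v
  rw [hv, map_zero, zero_add] at this
  exact this.symm

namespace LightlikeSubmanifold

theorem L_eq (S : LightlikeSubmanifold (m := m) g f r) (P : GoldenStructure g)
    {W : Π x : N, TangentSpace (𝓡 m) x} (hW : ∀ x, W x ∈ radical g f x) :
    S.L P W = fun x ↦ P.val (f x) (differential f x (W x)) := by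
  funext x
  have : S.projRadical x (W x) = W x := by
    simp only [projRadical, LinearMap.comp_apply, Submodule.subtype_apply]
    exact congrArg Subtype.val
      (Submodule.projectionOnto_apply_left (S.isCompl_screen x) ⟨W x, hW x⟩)
  rw [L, this]

/-- The `S(TN^⊥)`-component of `P v`, for `v` tangent to `N`, vanishes only on the radical. -/
theorem projScreenTransversal_golden_eq_zero_iff (hS : S.IsTransversal P) (x : N)
    (v : TangentSpace (𝓡 m) x) :
    S.projScreenTransversal x (P.val (f x) (differential f x v)) = 0 ↔ v ∈ radical g f x := by
  have hker : ∀ z, S.projScreenTransversal x z = 0 ↔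
      z ∈ LinearMap.range (differential (m := m) (n := n) f x) ⊔ S.ltr x := by
    intro z
    simp only [projScreenTransversal, LinearMap.comp_apply, Submodule.subtype_apply]
    rw [ZeroMemClass.coe_eq_zero, Submodule.projectionOnto_apply_eq_zero_iff]
  have hrad : ∀ v ∈ radical (m := m) g f x,
      S.projScreenTransversal x (P.val (f x) (differential f x v)) = 0 := by
    intro v hv
    rw [hker, ← hS.map_radical x]
    exact Submodule.mem_sup_right ⟨_, ⟨v, hv, rfl⟩, rfl⟩
  refine ⟨fun h ↦ ?_, hrad v⟩
  have hv : v ∈ radical (m := m) g f x ⊔ S.screen x := by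
    rw [(S.isCompl_screen x).sup_eq_top]; trivial
  obtain ⟨ρ, hρ, s, hs, rfl⟩ := Submodule.mem_sup.1 hv
  rw [map_add, map_add, map_add, hrad ρ hρ, zero_add, hker] at h
  -- The screen part gives a vector in `S(TN^⊥)` and also in the complementary `TN ⊕ ltr(TN)`.
  have h0 : P.val (f x) (differential f x s) = 0 :=
    Submodule.disjoint_def.1 (S.isCompl_screenTransversal x).disjoint _
      (hS.map_screen x ⟨_, ⟨s, hs, rfl⟩, rfl⟩) h
  have hs' : s ∈ radical (m := m) g f x := by
    change differential f x s ∈ normalSpace (m := m) g f x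
    rw [P.eq_zero_of_val_eq_zero h0]
    exact Submodule.zero_mem _
  exact Submodule.add_mem _ hρ hs'

/-- `D^s(U, LW) - D^s(W, LU)` is the component of `P [U, W]` in `S(TN^⊥)`. -/
theorem Ds_L_sub_Ds_L (hcov : cov.torsion = 0) (hP : P.IsLocallyGolden cov)
    {U W : Π x : N, TangentSpace (𝓡 m) x}
    (hU : IsSectionOf (radical g f) U) (hW : IsSectionOf (radical g f) W) (x : N) :
    S.Ds cov U (S.L P W) x - S.Ds cov W (S.L P U) x
      = S.projScreenTransversal x (P.val (f x) (differential f x (mlieBracket (𝓡 m) U W x))) := by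
  have hf : ContMDiffAt (𝓡 m) (𝓡 n) ∞ f x := S.isImmersion.contMDiff x
  have hU' := hU.1.mdifferentiableAt (x := x) (by simp)
  have hW' := hW.1.mdifferentiableAt (x := x) (by simp)
  have hd : ∀ {W : Π x : N, TangentSpace (𝓡 m) x},
      MDifferentiableAt (𝓡 m) (𝓡 m).tangent (fun y ↦ (⟨y, W y⟩ : TangentBundle (𝓡 m) N)) x →
      MDifferentiableAt (𝓡 m) 𝓘(ℝ, EuclideanSpace ℝ (Fin n))
        (fun y ↦ (triv n (f x) ⟨f y, differential f y (W y)⟩).2) x := fun hW ↦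
    (mdifferentiableAt_mvfderiv_apply (contMDiffAt_extChartAt_comp hf) hW).congr_of_eventuallyEq
      (eventually_triv_differential hf _)
  have hfd := hf.mdifferentiableAt (by simp)
  rw [Ds, Ds, S.L_eq P hU.2, S.L_eq P hW.2, covAlong_golden P hP hfd (hd hW'),
    covAlong_golden P hP hfd (hd hU'), ← map_sub, ← map_sub,
    covAlong_differential_sub cov hcov hf hU' hW']

/-- The condition on `D^s` means that the radical distribution is involutive. -/
theorem Ds_L_eq_iff_mlieBracket_mem (hcov : cov.torsion = 0) (hP : P.IsLocallyGolden cov)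
    (hS : S.IsTransversal P) {U W : Π x : N, TangentSpace (𝓡 m) x}
    (hU : IsSectionOf (radical g f) U) (hW : IsSectionOf (radical g f) W) (x : N) :
    S.Ds cov U (S.L P W) x = S.Ds cov W (S.L P U) x ↔
      mlieBracket (𝓡 m) U W x ∈ radical g f x := by
  rw [← sub_eq_zero, Ds_L_sub_Ds_L hcov hP hU hW, projScreenTransversal_golden_eq_zero_iff hS]

end LightlikeSubmanifold

end Radical

/-! ### Frobenius' theorem for distributions on manifolds -/

/-! ### Normalization of injective operator fields -/

section LeftInverse

open Filter Topology

variable {H F E : Type*} [NormedAddCommGroup H] [NormedSpace ℝ H]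
  [NormedAddCommGroup F] [NormedSpace ℝ F] [FiniteDimensional ℝ F]
  [NormedAddCommGroup E] [NormedSpace ℝ E] [FiniteDimensional ℝ E]

/-- A smooth field of operators which is injective at a point can be normalized near this point, so
that it has a constant left inverse `B`. -/
theorem exists_contDiffOn_normalization {T : H → F →L[ℝ] E} {s : Set H} (hs : IsOpen s)
    (hT : ContDiffOn ℝ ∞ T s) {u₀ : H} (hu₀ : u₀ ∈ s) (hinj : Function.Injective (T u₀)) :
    ∃ (B : E →L[ℝ] F) (C : H → F →L[ℝ] F) (s' : Set H), IsOpen s' ∧ s' ⊆ s ∧ u₀ ∈ s' ∧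
      ContDiffOn ℝ ∞ C s' ∧ ∀ u ∈ s', (∀ v, C u (B (T u v)) = v) ∧ ∀ v, B (T u (C u v)) = v := by
  obtain ⟨B, hB⟩ := ContinuousLinearMap.HasLeftInverse.of_injective_of_finiteDimensional hinj
  have hBT : ContDiffOn ℝ ∞ (fun u ↦ B ∘L T u) s := contDiffOn_const.clm_comp hT
  have : CompleteSpace F := FiniteDimensional.complete ℝ F
  -- `B` is a left inverse of `T u₀`, so `B ∘ T u` is the identity at `u₀` and stays invertible
  -- nearby; `C u` is its inverse.
  refine ⟨B, fun u ↦ Ring.inverse (B ∘L T u), s ∩ {u | IsUnit (B ∘L T u)}, ?_,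
    inter_subset_left, ⟨hu₀, ?_⟩, ?_, ?_⟩
  · exact hBT.continuousOn.isOpen_inter_preimage hs Units.isOpen
  · have h1 : B ∘L T u₀ = 1 := by
      ext v
      simp [hB v]
    simp [h1]
  · rintro u ⟨hu, hunit⟩
    obtain ⟨w, hw⟩ := hunit
    have h1 : ContDiffAt ℝ ∞ Ring.inverse (B ∘L T u) := hw ▸ contDiffAt_ringInverse ℝ w
    exact (h1.comp u (hBT.contDiffAt (hs.mem_nhds hu))).contDiffWithinAt
  · rintro u ⟨hu, hunit⟩
    exact ⟨fun v ↦ DFunLike.congr_fun (Ring.inverse_mul_cancel _ hunit) v,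
      fun v ↦ DFunLike.congr_fun (Ring.mul_inverse_cancel _ hunit) v⟩

end LeftInverse

/-! ### Integrable distributions are involutive -/

section Distribution

open Filter Topology VectorField

variable {m : ℕ} {N : Type*} [TopologicalSpace N]
  [ChartedSpace (EuclideanSpace ℝ (Fin m)) N] [IsManifold (𝓡 m) ∞ N]
  {D : Π x : N, Submodule ℝ (TangentSpace (𝓡 m) x)}

theorem mvfderiv_extChartAt_injective {p q : N}
    (hq : q ∈ (chartAt (EuclideanSpace ℝ (Fin m)) p).source) :
    Function.Injective (mvfderiv (𝓡 m) (extChartAt (𝓡 m) p) q) := by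
  intro v w hvw
  rw [← triv_apply_snd hq, ← triv_apply_snd hq] at hvw
  rw [← symmL_triv_apply_snd_of_mem (p := p) (q := q) hq v, hvw, symmL_triv_apply_snd_of_mem hq]

/-- The bracket of two sections of an integrable distribution is a section of it. -/
theorem IsIntegrable.mlieBracket_mem (hD : IsIntegrable D) {U W : Π x : N, TangentSpace (𝓡 m) x}
    (hU : IsSectionOf D U) (hW : IsSectionOf D W) (x : N) : mlieBracket (𝓡 m) U W x ∈ D x := by
  obtain ⟨k, O, φ, hO, ⟨u₀, hu₀, rfl⟩, -, hφ, hφD⟩ := hD x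
  set ψ := extChartAt (𝓡 m) (φ u₀) with hψ
  set src := (chartAt (EuclideanSpace ℝ (Fin m)) (φ u₀)).source with hsrc
  have hx : φ u₀ ∈ src := mem_chart_source _ _
  set O' := O ∩ φ ⁻¹' src with hO'
  have hO'open : IsOpen O' := hφ.continuousOn.isOpen_inter_preimage hO (chartAt _ _).open_source
  have hu₀' : u₀ ∈ O' := ⟨hu₀, hx⟩
  have hφd : ∀ u ∈ O', MDifferentiableAt (𝓡 k) (𝓡 m) φ u := fun u hu ↦
    (hφ.contMDiffAt (hO.mem_nhds hu.1)).mdifferentiableAt (by simp)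
  set h : EuclideanSpace ℝ (Fin k) → EuclideanSpace ℝ (Fin m) := fun u ↦ ψ (φ u) with hh
  have hhs : ContDiffOn ℝ ∞ h O' := by
    rw [← contMDiffOn_iff_contDiffOn]
    exact (contMDiffOn_extChartAt (I := 𝓡 m) (x := φ u₀)).comp (hφ.mono inter_subset_left)
      fun u hu ↦ hu.2
  have hh' : ∀ u ∈ O', ∀ v, fderiv ℝ h u v = mvfderiv (𝓡 m) ψ (φ u) (mfderiv (𝓡 k) (𝓡 m) φ u v) :=
    fun u hu v ↦ fderiv_comp_apply_mfderiv (mdifferentiableAt_extChartAt hu.2) (hφd u hu) v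
  have hinj : Function.Injective (fderiv ℝ h u₀) := by
    intro v w hvw
    rw [hh' u₀ hu₀', hh' u₀ hu₀'] at hvw
    exact (hφD u₀ hu₀).1 (mvfderiv_extChartAt_injective hx hvw)
  obtain ⟨B, C, s', hs', hs'O, hus', hC, hCB⟩ := exists_contDiffOn_normalization hO'open
    (hhs.fderiv_of_isOpen (m := ∞) hO'open (by simp)) hu₀' hinj
  -- the pullback of a section
  have hpull : ∀ {W : Π x : N, TangentSpace (𝓡 m) x}, IsSectionOf D W →
      ∃ w : EuclideanSpace ℝ (Fin k) → EuclideanSpace ℝ (Fin k), DifferentiableAt ℝ w u₀ ∧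
        (mfderiv (𝓡 k) (𝓡 m) φ u₀ (w u₀) = W (φ u₀)) ∧
        (fun u ↦ fderiv ℝ h u (w u)) =ᶠ[𝓝 u₀] fun u ↦ mvfderiv (𝓡 m) ψ (φ u) (W (φ u)) := by
    intro W hW
    have heq : ∀ u ∈ s', fderiv ℝ h u (C u (B (mvfderiv (𝓡 m) ψ (φ u) (W (φ u)))))
        = mvfderiv (𝓡 m) ψ (φ u) (W (φ u)) := by
      intro u hu
      have hWu := hW.2 (φ u)
      rw [← (hφD u (hs'O hu).1).2] at hWu
      obtain ⟨v, hv⟩ : ∃ v : EuclideanSpace ℝ (Fin k), mfderiv (𝓡 k) (𝓡 m) φ u v = W (φ u) := hWu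
      have hv' : fderiv ℝ h u v = mvfderiv (𝓡 m) ψ (φ u) (W (φ u)) :=
        (hh' u (hs'O hu) v).trans (congrArg (mvfderiv (𝓡 m) ψ (φ u)) hv)
      rw [← hv', (hCB u hu).1]
    -- `W` is tangent to the integral manifold, so it has a preimage under the differential at each
    -- point; the left inverse `C u ∘ B` makes it depend differentiably on `u`.
    refine ⟨fun u ↦ C u (B (mvfderiv (𝓡 m) ψ (φ u) (W (φ u)))), ?_, ?_, ?_⟩
    · have h1 : MDifferentiableAt (𝓡 m) 𝓘(ℝ, EuclideanSpace ℝ (Fin m))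
          (fun y ↦ mvfderiv (𝓡 m) ψ y (W y)) (φ u₀) :=
        mdifferentiableAt_mvfderiv_apply contMDiffAt_extChartAt
          (hW.1.mdifferentiableAt (x := φ u₀) (by simp))
      have h2 := (h1.comp u₀ (hφd u₀ hu₀')).differentiableAt
      exact ((hC.contDiffAt (hs'.mem_nhds hus')).differentiableAt (by simp)).clm_apply
        (B.differentiableAt.comp u₀ h2)
    · have := heq u₀ hus'
      rw [hh' u₀ hu₀'] at this
      exact mvfderiv_extChartAt_injective hx this
    · filter_upwards [hs'.mem_nhds hus'] with u hu using heq u hu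
  obtain ⟨a, ha, ha₀, hae⟩ := hpull hU
  obtain ⟨b, hb, hb₀, hbe⟩ := hpull hW
  -- `[U, W]` has the same coordinates as the image of the bracket of the pullbacks `a`, `b`, so it
  -- lies in the range of `dφ`.
  have hbr := fderiv_apply_lieBracket (hhs.contDiffAt (hO'open.mem_nhds hu₀'))
    (by rw [minSmoothness_of_isRCLikeNormedField]; norm_cast) hb ha
  have hstep : ∀ {W : Π x : N, TangentSpace (𝓡 m) x}, IsSectionOf D W → ∀ v,
      fderiv ℝ (fun u ↦ mvfderiv (𝓡 m) ψ (φ u) (W (φ u))) u₀ v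
        = mvfderiv (𝓡 m) (fun y ↦ mvfderiv (𝓡 m) ψ y (W y)) (φ u₀)
          (mfderiv (𝓡 k) (𝓡 m) φ u₀ v) := fun hW v ↦
    fderiv_comp_apply_mfderiv (g := fun y ↦ mvfderiv (𝓡 m) ψ y (_))
      (mdifferentiableAt_mvfderiv_apply contMDiffAt_extChartAt
        (hW.1.mdifferentiableAt (x := φ u₀) (by simp))) (hφd u₀ hu₀') v
  rw [hbe.fderiv_eq, hae.fderiv_eq, hstep hW, hstep hU, ha₀, hb₀,
    ← mvfderiv_mlieBracket contMDiffAt_extChartAt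
      (hU.1.mdifferentiableAt (x := φ u₀) (by simp))
      (hW.1.mdifferentiableAt (x := φ u₀) (by simp)), hh' u₀ hu₀'] at hbr
  rw [← (hφD u₀ hu₀).2, ← mvfderiv_extChartAt_injective hx hbr]
  exact ⟨_, rfl⟩

end Distribution

/-! ### Involutive distributions are integrable -/

section Frobenius

open Filter Topology VectorField

variable {m : ℕ} {N : Type*} [TopologicalSpace N]
  [ChartedSpace (EuclideanSpace ℝ (Fin m)) N] [IsManifold (𝓡 m) ∞ N]
  {D : Π x : N, Submodule ℝ (TangentSpace (𝓡 m) x)}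

/-- In a chart, a smooth distribution is the range of a smooth field `G` of operators with a
constant left inverse. -/
theorem IsSmoothDistribution.exists_range_eq {k : ℕ} (hD : IsSmoothDistribution k D) (x₀ : N) :
    ∃ (G : EuclideanSpace ℝ (Fin m) → EuclideanSpace ℝ (Fin k) →L[ℝ] EuclideanSpace ℝ (Fin m))
      (B : EuclideanSpace ℝ (Fin m) →L[ℝ] EuclideanSpace ℝ (Fin k))
      (s : Set (EuclideanSpace ℝ (Fin m))), IsOpen s ∧ s ⊆ (extChartAt (𝓡 m) x₀).target ∧
      extChartAt (𝓡 m) x₀ x₀ ∈ s ∧ ContDiffOn ℝ ∞ G s ∧ (∀ z ∈ s, ∀ ξ, B (G z ξ) = ξ) ∧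
      ∀ y ∈ (extChartAt (𝓡 m) x₀).source, extChartAt (𝓡 m) x₀ y ∈ s →
        ∀ v : TangentSpace (𝓡 m) y,
          v ∈ D y ↔ ∃ ξ, G (extChartAt (𝓡 m) x₀ y) ξ = mvfderiv (𝓡 m) (extChartAt (𝓡 m) x₀) y v := by
  obtain ⟨U, e, hU, hxU, he, heD⟩ := hD x₀
  set ψ := extChartAt (𝓡 m) x₀ with hψ
  have hsrc : ψ.source = (chartAt (EuclideanSpace ℝ (Fin m)) x₀).source := extChartAt_source _ _
  have hsrco : IsOpen ψ.source := isOpen_extChartAt_source x₀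
  have hx : x₀ ∈ ψ.source := mem_extChartAt_source x₀
  set c : Fin k → EuclideanSpace ℝ (Fin m) → EuclideanSpace ℝ (Fin m) :=
    fun i z ↦ (triv m x₀ ⟨ψ.symm z, e i (ψ.symm z)⟩).2 with hc
  set s₀ := ψ.target ∩ ψ.symm ⁻¹' U with hs₀
  have hs₀o : IsOpen s₀ := (continuousOn_extChartAt_symm x₀).isOpen_inter_preimage
    (isOpen_extChartAt_target x₀) hU
  have hz₀ : ψ x₀ ∈ s₀ := ⟨mem_extChartAt_target x₀, by
    rw [mem_preimage, hψ, extChartAt_to_inv]; exact hxU⟩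
  have hcs : ∀ i, ContDiffOn ℝ ∞ (c i) s₀ := by
    intro i
    rw [← contMDiffOn_iff_contDiffOn]
    have h1 : ContMDiffOn (𝓡 m) 𝓘(ℝ, EuclideanSpace ℝ (Fin m)) ∞
        (fun y ↦ (triv m x₀ ⟨y, e i y⟩).2) (U ∩ ψ.source) :=
      ((triv m x₀).contMDiffOn_section_iff (hU.inter hsrco) (fun y hy ↦ by
        have := hy.2; rw [hsrc] at this; simpa using this)).1 ((he i).mono inter_subset_left)
    exact h1.comp ((contMDiffOn_extChartAt_symm x₀).mono inter_subset_left)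
      fun z hz ↦ ⟨hz.2, ψ.map_target hz.1⟩
  -- The columns are the chart components of the local frame; `T ∘ C` below has the same range and
  -- the constant left inverse `B`.
  set T : EuclideanSpace ℝ (Fin m) → EuclideanSpace ℝ (Fin k) →L[ℝ] EuclideanSpace ℝ (Fin m) :=
    fun z ↦ ∑ i, (EuclideanSpace.proj (𝕜 := ℝ) i).smulRight (c i z) with hT
  have hTs : ContDiffOn ℝ ∞ T s₀ :=
    ContDiffOn.sum fun i _ ↦ contDiffOn_const.smulRight (hcs i)
  have hTv : ∀ y ∈ ψ.source, ∀ ξ : EuclideanSpace ℝ (Fin k),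
      T (ψ y) ξ = mvfderiv (𝓡 m) ψ y (∑ i, ξ i • e i y) := by
    intro y hy ξ
    have hci : ∀ i, c i (ψ y) = mvfderiv (𝓡 m) ψ y (e i y) := fun i ↦ by
      simp only [hc]
      rw [ψ.left_inv hy, triv_apply_snd (hsrc ▸ hy)]
    rw [map_sum]
    simp only [hT, sum_apply, ContinuousLinearMap.smulRight_apply, hci, map_smul]
    rfl
  have hTinj : Function.Injective (T (ψ x₀)) := by
    rw [injective_iff_map_eq_zero]
    intro ξ hξ
    rw [hTv x₀ hx] at hξ
    have h1 : ∑ i, ξ i • e i x₀ = 0 :=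
      mvfderiv_extChartAt_injective (hsrc ▸ hx) (hξ.trans (map_zero _).symm)
    ext i
    exact Fintype.linearIndependent_iff.1 (heD x₀ hxU).1 _ h1 i
  obtain ⟨B, C, s, hs, hss₀, hzs, hC, hCB⟩ := exists_contDiffOn_normalization hs₀o hTs hz₀ hTinj
  refine ⟨fun z ↦ T z ∘L C z, B, s, hs, hss₀.trans inter_subset_left, hzs,
    (hTs.mono hss₀).clm_comp hC, fun z hz ↦ (hCB z hz).2, fun y hy hys v ↦ ?_⟩
  have hyU : y ∈ U := by
    have := (hss₀ hys).2
    rwa [mem_preimage, ψ.left_inv hy] at this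
  rw [← (heD y hyU).2, Submodule.mem_span_range_iff_exists_fun]
  constructor
  · rintro ⟨a, rfl⟩
    refine ⟨B (T (ψ y) (WithLp.toLp 2 a)), ?_⟩
    rw [ContinuousLinearMap.comp_apply, (hCB _ hys).1, hTv y hy]
  · rintro ⟨ξ, hξ⟩
    refine ⟨fun i ↦ C (ψ y) ξ i, mvfderiv_extChartAt_injective (hsrc ▸ hy) ?_⟩
    rw [← hξ, ContinuousLinearMap.comp_apply, hTv y hy]

/-- Smooth functions of the coordinates extend locally to global vector fields. -/
theorem exists_isSectionOf [T2Space N] {x₀ : N} {s : Set (EuclideanSpace ℝ (Fin m))}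
    (hs : IsOpen s) {a : EuclideanSpace ℝ (Fin m) → EuclideanSpace ℝ (Fin m)}
    (ha : ContDiffOn ℝ ∞ a s)
    (haD : ∀ y ∈ (extChartAt (𝓡 m) x₀).source, extChartAt (𝓡 m) x₀ y ∈ s →
      ∀ v : TangentSpace (𝓡 m) y,
        mvfderiv (𝓡 m) (extChartAt (𝓡 m) x₀) y v = a (extChartAt (𝓡 m) x₀ y) → v ∈ D y)
    {y : N} (hy : y ∈ (extChartAt (𝓡 m) x₀).source) (hys : extChartAt (𝓡 m) x₀ y ∈ s) :
    ∃ W : Π x : N, TangentSpace (𝓡 m) x, IsSectionOf D W ∧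
      (fun q ↦ mvfderiv (𝓡 m) (extChartAt (𝓡 m) x₀) q (W q))
        =ᶠ[𝓝 y] fun q ↦ a (extChartAt (𝓡 m) x₀ q) := by
  set ψ := extChartAt (𝓡 m) x₀ with hψ
  have hsrc : ψ.source = (chartAt (EuclideanSpace ℝ (Fin m)) x₀).source := extChartAt_source _ _
  set O := ψ.source ∩ ψ ⁻¹' s with hO
  have hOo : IsOpen O := (continuousOn_extChartAt x₀).isOpen_inter_preimage
    (isOpen_extChartAt_source x₀) hs
  have hbase : ∀ q ∈ O, q ∈ (triv m x₀).baseSet := fun q hq ↦ by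
    have := hq.1; rw [hsrc] at this; simpa using this
  set Z : Π x : N, TangentSpace (𝓡 m) x := fun q ↦ (triv m x₀).symmL ℝ q (a (ψ q)) with hZ
  have hZv : ∀ q ∈ O, (triv m x₀ ⟨q, Z q⟩).2 = a (ψ q) := fun q hq ↦ by
    rw [← Trivialization.continuousLinearMapAt_apply_of_mem ℝ _ (hbase q hq)]
    exact Trivialization.continuousLinearMapAt_symmL _ (hbase q hq) _
  have hZψ : ∀ q ∈ O, mvfderiv (𝓡 m) ψ q (Z q) = a (ψ q) := fun q hq ↦ by
    rw [← hZv q hq, triv_apply_snd (hsrc ▸ hq.1)]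
  have hZs : ContMDiffOn (𝓡 m) (𝓡 m).tangent ∞ (fun q ↦ (⟨q, Z q⟩ : TangentBundle (𝓡 m) N)) O := by
    refine ((triv m x₀).contMDiffOn_section_iff hOo hbase).2 ?_
    refine ContMDiffOn.congr ?_ hZv
    exact ha.contMDiffOn.comp (contMDiffOn_extChartAt.mono fun q hq ↦ hsrc ▸ hq.1) fun q hq ↦ hq.2
  -- Involutivity is assumed for global sections only, so the local field is cut off by a bump
  -- function, equal to 1 near `y`.
  obtain ⟨χ, -, hχ⟩ := (SmoothBumpFunction.nhds_basis_tsupport (I := 𝓡 m) y).mem_iff.1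
    (hOo.mem_nhds ⟨hy, hys⟩)
  refine ⟨fun q ↦ χ q • Z q, ⟨?_, fun q ↦ ?_⟩, ?_⟩
  · exact ContMDiffOn.smul_section_of_tsupport χ.contMDiff.contMDiffOn hOo hχ hZs
  · by_cases hq : q ∈ O
    · exact Submodule.smul_mem _ _ (haD q hq.1 hq.2 _ (hZψ q hq))
    · have : χ q = 0 := image_eq_zero_of_notMem_tsupport fun h ↦ hq (hχ h)
      simp [this]
  · filter_upwards [χ.eventuallyEq_one, hOo.mem_nhds ⟨hy, hys⟩] with q h1 hq
    rw [h1, Pi.one_apply, one_smul, hZψ q hq]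

/-- **Frobenius' theorem**: an involutive smooth distribution is integrable. -/
theorem IsSmoothDistribution.isIntegrable [T2Space N] {k : ℕ} (hD : IsSmoothDistribution k D)
    (hinv : ∀ U W : Π x : N, TangentSpace (𝓡 m) x, IsSectionOf D U → IsSectionOf D W →
      ∀ x, mlieBracket (𝓡 m) U W x ∈ D x) : IsIntegrable D := by
  intro x₀
  obtain ⟨G, B, s, hs, hst, hx₀s, hG, hBG, hGD⟩ := hD.exists_range_eq x₀
  set ψ := extChartAt (𝓡 m) x₀ with hψ
  have hsrc : ψ.source = (chartAt (EuclideanSpace ℝ (Fin m)) x₀).source := extChartAt_source _ _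
  have hGd : ∀ z ∈ s, DifferentiableAt ℝ G z := fun z hz ↦
    (hG.contDiffAt (hs.mem_nhds hz)).differentiableAt (by simp)
  have hGξ : ∀ z ∈ s, ∀ ξ, HasFDerivAt (fun z ↦ G z ξ)
      ((ContinuousLinearMap.apply ℝ (EuclideanSpace ℝ (Fin m)) ξ) ∘L fderiv ℝ G z) z :=
    fun z hz ξ ↦ (ContinuousLinearMap.apply ℝ (EuclideanSpace ℝ (Fin m)) ξ).hasFDerivAt.comp z
      (hGd z hz).hasFDerivAt
  -- Differentiate the constant `B(Gξ) = ξ`.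
  have hBfd : ∀ z ∈ s, ∀ v ξ, B (fderiv ℝ G z v ξ) = 0 := by
    intro z hz v ξ
    have h1 := B.hasFDerivAt.comp z (hGξ z hz ξ)
    have h2 : (B ∘ fun z ↦ G z ξ) =ᶠ[𝓝 z] fun _ ↦ ξ := by
      filter_upwards [hs.mem_nhds hz] with w hw using hBG w hw ξ
    have h3 := h1.unique ((hasFDerivAt_const ξ z).congr_of_eventuallyEq h2)
    exact congrArg (fun A : EuclideanSpace ℝ (Fin m) →L[ℝ] EuclideanSpace ℝ (Fin k) ↦ A v) h3
  have hsymm : ∀ z ∈ s, ∀ ξ η, fderiv ℝ G z (G z ξ) η = fderiv ℝ G z (G z η) ξ := by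
    intro z hz ξ η
    set y := ψ.symm z with hy
    have hys : y ∈ ψ.source := ψ.map_target (hst hz)
    have hψy : ψ y = z := ψ.right_inv (hst hz)
    have hmd : MDifferentiableAt (𝓡 m) 𝓘(ℝ, EuclideanSpace ℝ (Fin m)) ψ y :=
      mdifferentiableAt_extChartAt (hsrc ▸ hys)
    have hsec : ∀ ξ, ∃ W : Π x : N, TangentSpace (𝓡 m) x, IsSectionOf D W ∧
        (fun q ↦ mvfderiv (𝓡 m) ψ q (W q)) =ᶠ[𝓝 y] fun q ↦ G (ψ q) ξ := fun ξ ↦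
      exists_isSectionOf hs (hG.clm_apply contDiffOn_const)
        (fun q hq hqs v hv ↦ (hGD q hq hqs v).2 ⟨ξ, hv.symm⟩) hys (by rw [← hψ, hψy]; exact hz)
    have hder : ∀ ξ v, mvfderiv (𝓡 m) (fun q ↦ G (ψ q) ξ) y v
        = fderiv ℝ G z (mvfderiv (𝓡 m) ψ y v) ξ := by
      intro ξ v
      have h1 := hGξ z hz ξ
      rw [← hψy] at h1
      refine (mvfderiv_comp_apply' (g := fun z ↦ G z ξ) (f := ψ)
        h1.differentiableAt.mdifferentiableAt hmd v).trans ?_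
      refine (mvfderiv_vectorSpace _ _ _).trans ?_
      rw [h1.fderiv, hψy]
      rfl
    obtain ⟨U, hU, hUe⟩ := hsec ξ
    obtain ⟨W, hW, hWe⟩ := hsec η
    have hUy : mvfderiv (𝓡 m) ψ y (U y) = G (ψ y) ξ := hUe.self_of_nhds
    have hWy : mvfderiv (𝓡 m) ψ y (W y) = G (ψ y) η := hWe.self_of_nhds
    have h1 := mvfderiv_mlieBracket (contMDiffAt_extChartAt' (I := 𝓡 m) (n := ∞) (x := x₀)
      (x' := y) (hsrc ▸ hys)) (hU.1.mdifferentiableAt (x := y) (by simp))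
      (hW.1.mdifferentiableAt (x := y) (by simp))
    rw [mvfderiv_congr hWe, mvfderiv_congr hUe, hder, hder, hUy, hWy, hψy] at h1
    -- The bracket of two columns is some `Gζ` by involutivity, while `B` kills its components;
    -- hence `ζ = BGζ = 0` and the columns commute.
    obtain ⟨ζ, hζ⟩ := (hGD y hys (by rw [hψy]; exact hz) _).1 (hinv U W hU hW y)
    rw [h1, hψy] at hζ
    have h2 := congrArg B hζ
    rw [hBG z hz, map_sub, hBfd z hz, hBfd z hz, sub_zero] at h2
    rw [h2, map_zero] at hζ
    exact sub_eq_zero.1 hζ.symm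
  obtain ⟨O, φ, hO, h0, hφ0, hφi, hφs, hφ⟩ :=
    exists_injOn_contDiffOn_hasFDerivAt hs hx₀s hG hBG hsymm
  have htgt : ∀ u ∈ O, φ u ∈ ψ.target := fun u hu ↦ hst (hφ u hu).1
  have hsm : ContMDiffOn (𝓡 k) (𝓡 m) ∞ (fun u ↦ ψ.symm (φ u)) O :=
    (contMDiffOn_extChartAt_symm x₀).comp hφs.contMDiffOn htgt
  refine ⟨k, O, fun u ↦ ψ.symm (φ u), hO, ⟨0, h0, ?_⟩, ?_, hsm, fun u hu ↦ ?_⟩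
  · simp only [hφ0]
    exact extChartAt_to_inv x₀
  · intro u hu v hv huv
    exact hφi hu hv (ψ.symm.injOn (htgt u hu) (htgt v hv) huv)
  have hus : ψ.symm (φ u) ∈ ψ.source := ψ.map_target (htgt u hu)
  have hψu : ψ (ψ.symm (φ u)) = φ u := ψ.right_inv (htgt u hu)
  have hinj := mvfderiv_extChartAt_injective (m := m) (p := x₀) (q := ψ.symm (φ u)) (hsrc ▸ hus)
  have hder : ∀ v : EuclideanSpace ℝ (Fin k), mvfderiv (𝓡 m) ψ (ψ.symm (φ u))
      (mfderiv (𝓡 k) (𝓡 m) (fun u ↦ ψ.symm (φ u)) u v) = G (φ u) v := by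
    intro v
    rw [← fderiv_comp_apply_mfderiv (mdifferentiableAt_extChartAt (hsrc ▸ hus))
      ((hsm.contMDiffAt (hO.mem_nhds hu)).mdifferentiableAt (by simp)) v]
    have h1 : (fun u ↦ ψ (ψ.symm (φ u))) =ᶠ[𝓝 u] φ := by
      filter_upwards [hO.mem_nhds hu] with w hw using ψ.right_inv (htgt w hw)
    rw [h1.fderiv_eq, (hφ u hu).2.fderiv]
  constructor
  · intro v w hvw
    exact (hBG _ (hφ u hu).1 v).symm.trans ((congrArg B ((hder v).symm.trans
      ((congrArg _ hvw).trans (hder w)))).trans (hBG _ (hφ u hu).1 w))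
  · ext w
    rw [hGD _ hus (by rw [hψu]; exact (hφ u hu).1), hψu]
    constructor
    · rintro ⟨v, rfl⟩
      exact ⟨v, (hder v).symm⟩
    · rintro ⟨ξ, hξ⟩
      exact ⟨ξ, hinj ((hder ξ).trans hξ)⟩

end Frobenius

end GoldenLightlike

end

/-! ### Integrability of the radical distribution -/

theorem mainTheorem6 {m n r : ℕ} {N M : Type*}
    [TopologicalSpace N] [T2Space N] [SecondCountableTopology N]
    [ChartedSpace (EuclideanSpace ℝ (Fin m)) N] [IsManifold (𝓡 m) ∞ N]
    [TopologicalSpace M] [T2Space M] [SecondCountableTopology M]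
    [ChartedSpace (EuclideanSpace ℝ (Fin n)) M] [IsManifold (𝓡 n) ∞ M]
    (g : GoldenLightlike.SemiRiemannianMetric n M)
    (P : GoldenLightlike.GoldenStructure g)
    (cov : CovariantDerivative (𝓡 n) (EuclideanSpace ℝ (Fin n))
      (fun p : M ↦ TangentSpace (𝓡 n) p))
    (hcov : GoldenLightlike.IsLeviCivita g cov)
    (hP : P.IsLocallyGolden cov)
    (f : N → M)
    (S : GoldenLightlike.LightlikeSubmanifold (m := m) g f r)
    (hS : S.IsTransversal P) :
    GoldenLightlike.IsIntegrable (GoldenLightlike.radical (m := m) g f) ↔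
      ∀ U W : (Π x : N, TangentSpace (𝓡 m) x),
        GoldenLightlike.IsSectionOf (GoldenLightlike.radical g f) U →
        GoldenLightlike.IsSectionOf (GoldenLightlike.radical g f) W →
        ∀ x : N, S.Ds cov U (S.L P W) x = S.Ds cov W (S.L P U) x := by
  have hint := fun {U W : Π x : N, TangentSpace (𝓡 m) x} hU hW ↦
    S.Ds_L_eq_iff_mlieBracket_mem hcov.torsion_eq_zero hP hS (U := U) (W := W) hU hW
  exact ⟨fun hI U W hU hW x ↦ (hint hU hW x).2 (hI.mlieBracket_mem hU hW x),
    fun h ↦ S.radical_smooth.isIntegrable fun U W hU hW x ↦ (hint hU hW x).1 (h U W hU hW x)⟩
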